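/- **Theorem.** Model of computation: a real RAM with unit-cost operations, that is, a machine whose registers hold real numbers and which executes in one step each of: loading an integer constant, copying (also with indirect addressing), $+,-,\times,/$, the floor function, a comparison of two registers with a conditional jump, writing a point to a write-only output, and a *line query*: given a point and a nonzero direction, it obtains the intersection of the input set $C$ with the corresponding line (reported as empty, or by the two endpoints of the intersection segment, in arbitrary order). Time is the number of steps, and space is the number of registers used. For a compact convex set $C\subset\mathbb{R}^2$ let $C^0=\operatorname{conv}(C\cap\mathbb{Z}^2)$ be its discrete hull, $|C^0|$ the number of vertices of $C^0$, and $\delta(C)$ the Euclidean diameter of $C$. Call $C\cap\mathbb{Z}^2$ *lattice-connected* if the graph on $C\cap\mathbb{Z}^2$ in which two points are adjacent when they are at distance $1$ is connected. There are a single program and absolute constants $T,S$ such that, for every compact convex set $C\subset\mathbb{R}^2$ (accessible by line queries only) for which $C\cap\mathbb{Z}^2$ is lattice-connected, and for every given point $v\in C\cap\mathbb{Z}^2$, the program started with the coordinates of $v$ halts after outputting the vertices of $C^0$, each exactly once and in counterclockwise order, and it takes at most $T\cdot|C^0|\log(2+\delta(C))$ time and at most $S$ space. In other words, $C^0$ can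 be computed in $O(|C^0|\log(2+\delta(C)))$ time and $O(1)$ space. -/

import Mathlib

/-! ### Geometry: lattice points, discrete hull, lattice-connectedness -/

/-- The Euclidean plane. -/
abbrev Plane : Type := EuclideanSpace ℝ (Fin 2)

/-- The point of the plane with given integer coordinates. -/
noncomputable def latticePoint (p : ℤ × ℤ) : Plane := !₂[(p.1 : ℝ), (p.2 : ℝ)]

/-- The integer points `C ∩ ℤ²` of a planar set, as a set of integer pairs. -/
def integerPoints (C : Set Plane) : Set (ℤ × ℤ) := {p | latticePoint p ∈ C}

/-- The discrete hull `C⁰ = conv (C ∩ ℤ²)`. -/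
def discreteHull (C : Set Plane) : Set Plane :=
  convexHull ℝ (C ∩ Set.range latticePoint)

/-- The number `|K|` of vertices of a convex polygon `K`. -/
noncomputable def numVertices (K : Set Plane) : ℕ := (K.extremePoints ℝ).ncard

/-- The lattice graph on `ℤ²`: its edges connect the lattice points at distance `1`. -/
def latticeGraph : SimpleGraph (ℤ × ℤ) where
  Adj p q := dist (latticePoint p) (latticePoint q) = 1
  symm := ⟨fun p q h => by rw [dist_comm]; exact h⟩
  loopless := ⟨fun p h => by simp at h⟩

/-- A set of lattice points is lattice-connected if it induces a connected subgraph
of the lattice graph. -/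
def LatticeConnected (S : Set (ℤ × ℤ)) : Prop := (latticeGraph.induce S).Connected

/-- Twice the signed area of the triangle `p q z`; it is nonnegative iff `z` lies on the
directed line from `p` to `q` or to the left of it (when `p ≠ q`). -/
noncomputable def cross (p q z : Plane) : ℝ :=
  (q 0 - p 0) * (z 1 - p 1) - (q 1 - p 1) * (z 0 - p 0)

/-- `l` lists the vertices of the convex polygon `K` (possibly degenerated to a segment or to a
point), each exactly once, in counterclockwise order around `K`: for any two cyclically
consecutive entries `p, q` of `l`, all of `K` lies on or to the left of the directed line `pq`. -/
def ListsVerticesCCW (l : List Plane) (K : Set Plane) : Prop :=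
  l.Nodup ∧ {x | x ∈ l} = K.extremePoints ℝ ∧
    ∀ (i : ℕ) (hi : i < l.length), ∀ z ∈ K,
      0 ≤ cross l[i] (l[(i + 1) % l.length]'(Nat.mod_lt _ (Nat.zero_lt_of_lt hi))) z

/-! ### Access to the input set: intersection with query lines -/

/-- The line through the point `p` with direction `d` (a line if `d ≠ 0`). -/
def lineThrough (p d : Plane) : Set Plane := {z | ∃ t : ℝ, z = p + t • d}

/-- A subroutine that receives a point and a direction of a line; `none` stands for an empty
intersection, and `some (a, b)` for the intersection segment with endpoints `a`, `b`. -/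
abbrev LineOracle : Type := Plane → Plane → Option (Plane × Plane)

/-- `Q` computes the intersection of `C` with every line. The order of the two reported
endpoints is arbitrary. -/
def LineOracle.Computes (Q : LineOracle) (C : Set Plane) : Prop :=
  ∀ p d : Plane, d ≠ 0 →
    match Q p d with
    | none => C ∩ lineThrough p d = ∅
    | some (a, b) => C ∩ lineThrough p d = segment ℝ a b

/-! ### The machine: a real RAM with floor function and line-intersection queries -/

/-- Instructions of the real RAM. Register `i` is written `R[i]`. -/
inductive Instr : Type
  /-- `R[d] := z` -/
  | const (d : ℕ) (z : ℤ)
  /-- `R[d] := R[s]` -/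
  | copy (d s : ℕ)
  /-- `R[d] := R[R[s]]` -/
  | load (d s : ℕ)
  /-- `R[R[d]] := R[s]` -/
  | store (d s : ℕ)
  /-- `R[d] := R[s] + R[t]` -/
  | add (d s t : ℕ)
  /-- `R[d] := R[s] - R[t]` -/
  | sub (d s t : ℕ)
  /-- `R[d] := R[s] * R[t]` -/
  | mul (d s t : ℕ)
  /-- `R[d] := R[s] / R[t]`; the machine gets stuck if `R[t] = 0` -/
  | div (d s t : ℕ)
  /-- `R[d] := ⌊R[s]⌋` -/
  | floor (d s : ℕ)
  /-- if `R[s] < R[t]`, continue at instruction `target`, else at the next instruction -/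
  | jumpLT (s t target : ℕ)
  /-- intersect the input set with the line through the point `(R[s], R[s+1])` with direction
  `(R[s+2], R[s+3])`; if the intersection is empty, set `R[d] := 0`, otherwise set `R[d] := 1`
  and store the endpoints of the intersection as `(R[d+1], R[d+2])` and `(R[d+3], R[d+4])`;
  the machine gets stuck if the direction is zero -/
  | query (d s : ℕ)
  /-- append the point `(R[s], R[t])` to the output -/
  | output (s t : ℕ)
  /-- stop -/
  | halt

/-- A program is a finite list of instructions, numbered from `0`. -/
abbrev Program : Type := List Instr

/-- A configuration of the machine. -/
structure Config : Type where
  /-- the number of the instruction to be executed next -/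
  pc : ℕ
  /-- the contents of the registers -/
  reg : ℕ → ℝ
  /-- the registers accessed (read or written) so far, including the input registers -/
  used : Finset ℕ
  /-- the points written so far to the write-only output -/
  out : List Plane

namespace Config

/-- The initial configuration: the input point `v` is in the registers `0` and `1`,
all the other registers hold `0`, and the output is empty. -/
noncomputable def init (v : ℤ × ℤ) : Config where
  pc := 0
  reg := fun i => if i = 0 then (v.1 : ℝ) else if i = 1 then (v.2 : ℝ) else 0
  used := {0, 1}
  out := []

/-- Record access to the registers `A`, and go to the next instruction. -/
def next (c : Config) (A : Finset ℕ) : Config :=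
  { c with pc := c.pc + 1, used := c.used ∪ A }

/-- Set `R[d] := x`. -/
def set (c : Config) (d : ℕ) (x : ℝ) : Config :=
  { c with reg := Function.update c.reg d x }

end Config

/-- The register address given by a real number, if it is a natural number. -/
noncomputable def address (x : ℝ) : Option ℕ :=
  open Classical in if ((⌊x⌋₊ : ℕ) : ℝ) = x then some ⌊x⌋₊ else none

open Classical in
/-- The effect of one instruction; `none` if the machine stops or gets stuck. -/
noncomputable def execute (Q : LineOracle) (c : Config) : Instr → Option Config
  | .const d z => some ((c.set d (z : ℝ)).next {d})
  | .copy d s => some ((c.set d (c.reg s)).next {d, s})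
  | .load d s =>
      (address (c.reg s)).map fun a => (c.set d (c.reg a)).next {d, s, a}
  | .store d s =>
      (address (c.reg d)).map fun a => (c.set a (c.reg s)).next {d, s, a}
  | .add d s t => some ((c.set d (c.reg s + c.reg t)).next {d, s, t})
  | .sub d s t => some ((c.set d (c.reg s - c.reg t)).next {d, s, t})
  | .mul d s t => some ((c.set d (c.reg s * c.reg t)).next {d, s, t})
  | .div d s t =>
      if c.reg t = 0 then none
      else some ((c.set d (c.reg s / c.reg t)).next {d, s, t})
  | .floor d s => some ((c.set d ((⌊c.reg s⌋ : ℤ) : ℝ)).next {d, s})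
  | .jumpLT s t target =>
      if c.reg s < c.reg t then some { c.next {s, t} with pc := target }
      else some (c.next {s, t})
  | .query d s =>
      if c.reg (s + 2) = 0 ∧ c.reg (s + 3) = 0 then none
      else
        let A : Finset ℕ := {s, s + 1, s + 2, s + 3, d, d + 1, d + 2, d + 3, d + 4}
        match Q !₂[c.reg s, c.reg (s + 1)] !₂[c.reg (s + 2), c.reg (s + 3)] with
        | none => some ((c.set d 0).next A)
        | some (a, b) =>
            some ((((((c.set d 1).set (d + 1) (a 0)).set (d + 2) (a 1)).set
              (d + 3) (b 0)).set (d + 4) (b 1)).next A)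
  | .output s t =>
      some { c.next {s, t} with out := c.out ++ [!₂[c.reg s, c.reg t]] }
  | .halt => none

/-- One step of the program: execute the instruction numbered `c.pc`
(the machine gets stuck if there is none). -/
noncomputable def step (P : Program) (Q : LineOracle) (c : Config) : Option Config :=
  (P[c.pc]?).bind (execute Q c)

/-- The configuration after exactly `n` steps, if the machine does not stop earlier. -/
noncomputable def runFor (P : Program) (Q : LineOracle) : ℕ → Config → Option Config
  | 0, c => some c
  | n + 1, c => (step P Q c).bind (runFor P Q n)

/-- Started at `c`, the program `P` with subroutine `Q` runs for `n` steps (every instruction,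
including a query, costs one step) and then properly halts in the configuration `c'`. -/
def HaltsAfter (P : Program) (Q : LineOracle) (c : Config) (n : ℕ) (c' : Config) : Prop :=
  runFor P Q n c = some c' ∧ P[c'.pc]? = some Instr.halt

/-! The algorithm is gift wrapping. A line query with an integer base point X and direction D,
followed by rounding, gives the integers t with X + tD in C as an interval (`lineRange_spec`); the
set S of lattice points is examined in no other way.

A first vertex is the last point of the lowest row. Doubling and bisection find a nonempty row above
an empty one in logarithmic time, and lattice-connectedness puts all of S above the empty row
(`LatticeConnected.row`).

From a vertex p, the next edge direction is sought by a Euclid-like search. `SearchInv` keeps a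
lattice basis u, w with p + w in S and p + u not in S, such that the part of S to the right of w
lies to the left of u. It starts with adjacent axis directions; there the invariant holds because a
lattice path cannot leave an open quadrant without meeting its boundary rays
(`LatticeConnected.quadrant`). A round pushes w towards u as far as S allows, then u towards w as
far as possible while staying outside S. If the ray p + u + sw, s ≥ 0, misses S, nothing lies to the
right of w, and the last point of S on the ray along w is the next vertex (`left_of_forall_not_mem`,
`supp_of_left`). Otherwise, from the second round on, the height of u + w over the initial direction
at least doubles, while p + u + w stays in S; so the number of rounds is logarithmic in the diameter
(`search_spec_of_add_mem`).

A vertex has at most one vertex as predecessor (`Next.injective`), so the walk can close only at its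
start, within as many rounds as there are vertices. A closed walk meets every vertex, without any
winding argument: S lies in the angle at each visited vertex, so a linear functional maximal among
the visited points at q is maximal on S at q (`subset_convexHull_of_next`).

Running time is carried through a cost-bounded weakest precondition `Wp`. Space is read off the
program text, which uses only direct addresses below 32. -/

/-! ### Structured code fragments and their cost-bounded weakest preconditions -/

/-- A code fragment: the instructions, as a function of the position of the first of them. -/
abbrev Frag : Type := ℕ → List Instr

namespace Frag

/-- Straight-line code. -/
def block (l : List Instr) : Frag := fun _ => l

/-- Sequential composition. -/
def seq (f g : Frag) : Frag := fun k => f k ++ g (k + (f k).length)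

/-- Execute `f` unless `R[s] < R[t]`. -/
def unlessLT (s t : ℕ) (f : Frag) : Frag :=
  fun k => Instr.jumpLT s t (k + 1 + (f (k + 1)).length) :: f (k + 1)

/-- Execute `f` at least once, and repeat as long as `R[s] < R[t]` afterwards. -/
def doWhile (s t : ℕ) (f : Frag) : Frag := fun k => f k ++ [Instr.jumpLT s t k]

end Frag

/-- The instructions `l` stand in `P` from position `k` on. -/
def CodeAt (P : Program) (k : ℕ) (l : List Instr) : Prop :=
  ∃ pre post, P = pre ++ (l ++ post) ∧ pre.length = k

theorem CodeAt.left {P : Program} {k : ℕ} {l m : List Instr} (h : CodeAt P k (l ++ m)) :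
    CodeAt P k l := by
  obtain ⟨pre, post, rfl, rfl⟩ := h
  exact ⟨pre, m ++ post, by simp, rfl⟩

theorem CodeAt.right {P : Program} {k : ℕ} {l m : List Instr} (h : CodeAt P k (l ++ m)) :
    CodeAt P (k + l.length) m := by
  obtain ⟨pre, post, rfl, rfl⟩ := h
  exact ⟨pre ++ l, post, by simp, by simp⟩

theorem CodeAt.head {P : Program} {k : ℕ} {i : Instr} {m : List Instr}
    (h : CodeAt P k (i :: m)) : P[k]? = some i := by
  obtain ⟨pre, post, rfl, rfl⟩ := h
  simp

theorem CodeAt.tail {P : Program} {k : ℕ} {i : Instr} {m : List Instr}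
    (h : CodeAt P k (i :: m)) : CodeAt P (k + 1) m :=
  CodeAt.right (l := [i]) h

theorem runFor_add (P : Program) (Q : LineOracle) (m n : ℕ) (c : Config) :
    runFor P Q (m + n) c = (runFor P Q m c).bind (runFor P Q n) := by
  induction m generalizing c with
  | zero => simp [runFor]
  | succ m ih =>
    rw [Nat.succ_add]
    simp only [runFor]
    cases step P Q c with
    | none => rfl
    | some c' => simp [ih]

theorem runFor_one {P : Program} {Q : LineOracle} {c c' : Config} {i : Instr}
    (hi : P[c.pc]? = some i) (h : execute Q c i = some c') : runFor P Q 1 c = some c' := by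
  simp [runFor, step, hi, h]

/-- Wherever the fragment `f` stands in a program, when started with the registers `r` and the
output `o` it is left after at most `n` steps at its end, with registers and output that
satisfy `Post`. -/
def Wp (Q : LineOracle) (f : Frag) (n : ℕ) (r : ℕ → ℝ) (o : List Plane)
    (Post : (ℕ → ℝ) → List Plane → Prop) : Prop :=
  ∀ (P : Program) (k : ℕ), CodeAt P k (f k) → ∀ U : Finset ℕ,
    ∃ m ≤ n, ∃ r' o' U', runFor P Q m ⟨k, r, U, o⟩ = some ⟨k + (f k).length, r', U', o'⟩ ∧
      Post r' o'

section Rules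

variable {Q : LineOracle} {f g : Frag} {n m : ℕ} {r : ℕ → ℝ} {o : List Plane}
  {Post Post' : (ℕ → ℝ) → List Plane → Prop}

theorem Wp.mono (h : Wp Q f n r o Post) (hnm : n ≤ m) (hp : ∀ r o, Post r o → Post' r o) :
    Wp Q f m r o Post' := by
  intro P k hc U
  obtain ⟨a, ha, r', o', U', h1, h2⟩ := h P k hc U
  exact ⟨a, ha.trans hnm, r', o', U', h1, hp _ _ h2⟩

theorem Wp.seq (h : Wp Q f n r o fun r' o' => Wp Q g m r' o' Post) :
    Wp Q (f.seq g) (n + m) r o Post := by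
  intro P k hc U
  obtain ⟨a, ha, r', o', U', h1, h2⟩ := h P k hc.left U
  obtain ⟨b, hb, r'', o'', U'', h3, h4⟩ := h2 P _ hc.right U'
  refine ⟨a + b, by omega, r'', o'', U'', ?_, h4⟩
  rw [runFor_add, h1]
  simp only [Option.bind_some, h3, Frag.seq, List.length_append, Nat.add_assoc]

theorem Wp.nil (h : Post r o) : Wp Q (Frag.block []) 0 r o Post :=
  fun _ _ _ U => ⟨0, le_rfl, r, o, U, rfl, h⟩

theorem Wp.cons {i : Instr} {l : List Instr} {r' : ℕ → ℝ} {o' : List Plane}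
    (hi : ∀ pc U, ∃ U', execute Q ⟨pc, r, U, o⟩ i = some ⟨pc + 1, r', U', o'⟩)
    (h : Wp Q (Frag.block l) n r' o' Post) : Wp Q (Frag.block (i :: l)) (n + 1) r o Post := by
  intro P k hc U
  obtain ⟨U', hU'⟩ := hi k U
  obtain ⟨a, ha, r'', o'', U'', h1, h2⟩ := h P (k + 1) (CodeAt.tail hc) U'
  refine ⟨1 + a, by omega, r'', o'', U'', ?_, h2⟩
  rw [runFor_add, runFor_one (CodeAt.head hc) hU']
  simp only [Option.bind_some, h1, Frag.block, List.length_cons]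
  congr 2
  omega

theorem Wp.unlessLT {s t : ℕ} (h1 : r s < r t → Post r o)
    (h2 : ¬ r s < r t → Wp Q f n r o Post) : Wp Q (f.unlessLT s t) (n + 1) r o Post := by
  intro P k hc U
  by_cases hst : r s < r t
  · refine ⟨1, by omega, r, o, U ∪ {s, t}, ?_, h1 hst⟩
    rw [runFor_one (CodeAt.head hc) (by simp only [execute, if_pos hst]; rfl)]
    simp only [Frag.unlessLT, List.length_cons]
    congr 2
    omega
  · obtain ⟨a, ha, r'', o'', U'', h3, h4⟩ := h2 hst P (k + 1) (CodeAt.tail hc) (U ∪ {s, t})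
    refine ⟨1 + a, by omega, r'', o'', U'', ?_, h4⟩
    rw [runFor_add, runFor_one (CodeAt.head hc) (by simp only [execute, if_neg hst]; rfl)]
    simp only [Option.bind_some, Config.next, h3, Frag.unlessLT, List.length_cons]
    congr 2
    omega

/-- Only one round is unrolled, and the remaining rounds reappear with their own budget `m`. Every
loop is therefore verified by induction on a bound for its number of rounds. -/
theorem Wp.doWhile {s t : ℕ}
    (h : Wp Q f n r o fun r' o' =>
      (r' s < r' t → Wp Q (f.doWhile s t) m r' o' Post) ∧ (¬ r' s < r' t → Post r' o')) :
    Wp Q (f.doWhile s t) (n + 1 + m) r o Post := by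
  intro P k hc U
  obtain ⟨a, ha, r', o', U', h1, h2, h3⟩ := h P k hc.left U
  have hj := CodeAt.head hc.right
  by_cases hst : r' s < r' t
  · obtain ⟨b, hb, r'', o'', U'', h4, h5⟩ := h2 hst P k hc (U' ∪ {s, t})
    refine ⟨a + (1 + b), by omega, r'', o'', U'', ?_, h5⟩
    rw [runFor_add, h1, Option.bind_some, runFor_add,
      runFor_one (c := ⟨_, r', U', o'⟩) hj (by simp only [execute, if_pos hst]; rfl)]
    exact h4
  · refine ⟨a + 1, by omega, r', o', U' ∪ {s, t}, ?_, h3 hst⟩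
    rw [runFor_add, h1, Option.bind_some,
      runFor_one (c := ⟨_, r', U', o'⟩) hj (by simp only [execute, if_neg hst]; rfl)]
    simp [Frag.doWhile, Config.next, Nat.add_assoc]

/-- The effect of the arithmetic instructions on the registers. -/
noncomputable def Instr.eval : Instr → (ℕ → ℝ) → ℕ → ℝ
  | .const d z, r => Function.update r d (z : ℝ)
  | .copy d s, r => Function.update r d (r s)
  | .add d s t, r => Function.update r d (r s + r t)
  | .sub d s t, r => Function.update r d (r s - r t)
  | .mul d s t, r => Function.update r d (r s * r t)
  | .div d s t, r => Function.update r d (r s / r t)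
  | .floor d s, r => Function.update r d ((⌊r s⌋ : ℤ) : ℝ)
  | _, r => r

/-- The arithmetic instructions that cannot fail in the state `r`. -/
def Instr.Safe : Instr → (ℕ → ℝ) → Prop
  | .const _ _, _ => True
  | .copy _ _, _ => True
  | .add _ _ _, _ => True
  | .sub _ _ _, _ => True
  | .mul _ _ _, _ => True
  | .div _ _ t, r => r t ≠ 0
  | .floor _ _, _ => True
  | _, _ => False

theorem Instr.execute_of_safe {i : Instr} (h : i.Safe r) (pc : ℕ) (U : Finset ℕ) :
    ∃ U', execute Q ⟨pc, r, U, o⟩ i = some ⟨pc + 1, i.eval r, U', o⟩ := by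
  cases i <;> first
    | exact h.elim
    | exact ⟨_, rfl⟩
    | exact ⟨_, if_neg h⟩

/-- Straight-line arithmetic code runs without failure from the state `r`. -/
def SafeBlock : List Instr → (ℕ → ℝ) → Prop
  | [], _ => True
  | i :: l, r => i.Safe r ∧ SafeBlock l (i.eval r)

/-- The effect of straight-line arithmetic code. -/
noncomputable def evalBlock : List Instr → (ℕ → ℝ) → ℕ → ℝ
  | [], r => r
  | i :: l, r => evalBlock l (i.eval r)

theorem Wp.block {l : List Instr} (hl : l.length ≤ n) (hs : SafeBlock l r)
    (h : Post (evalBlock l r) o) : Wp Q (Frag.block l) n r o Post := by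
  refine Wp.mono (n := l.length) (Post := Post) ?_ hl fun _ _ h => h
  clear hl
  induction l generalizing r with
  | nil => exact Wp.nil h
  | cons i l ih => exact Wp.cons (Instr.execute_of_safe hs.1) (ih hs.2 h)

theorem Wp.output {s t : ℕ} (h : Post r (o ++ [!₂[r s, r t]])) :
    Wp Q (Frag.block [.output s t]) 1 r o Post :=
  Wp.cons (fun _ _ => ⟨_, rfl⟩) (Wp.nil h)

theorem Wp.query {d s : ℕ} (hs : ¬ (r (s + 2) = 0 ∧ r (s + 3) = 0))
    (h0 : Q !₂[r s, r (s + 1)] !₂[r (s + 2), r (s + 3)] = none →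
      Post (Function.update r d 0) o)
    (h1 : ∀ a b, Q !₂[r s, r (s + 1)] !₂[r (s + 2), r (s + 3)] = some (a, b) →
      Post (Function.update (Function.update (Function.update (Function.update
        (Function.update r d 1) (d + 1) (a 0)) (d + 2) (a 1)) (d + 3) (b 0)) (d + 4) (b 1)) o) :
    Wp Q (Frag.block [.query d s]) 1 r o Post := by
  cases hq : Q !₂[r s, r (s + 1)] !₂[r (s + 2), r (s + 3)] with
  | none =>
    refine Wp.cons (fun pc U => ?_) (Wp.nil (h0 hq))
    simp only [execute, if_neg hs, hq]
    exact ⟨_, rfl⟩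
  | some ab =>
    refine Wp.cons (fun pc U => ?_) (Wp.nil (h1 ab.1 ab.2 hq))
    simp only [execute, if_neg hs, hq]
    exact ⟨_, rfl⟩

end Rules

/-! ### Space -/

/-- Only registers below `B` are accessed by the instruction, and by direct addressing. -/
def Instr.Below (B : ℕ) : Instr → Bool
  | .const d _ => d < B
  | .copy d s => d < B && s < B
  | .load _ _ => false
  | .store _ _ => false
  | .add d s t => d < B && s < B && t < B
  | .sub d s t => d < B && s < B && t < B
  | .mul d s t => d < B && s < B && t < B
  | .div d s t => d < B && s < B && t < B
  | .floor d s => d < B && s < B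
  | .jumpLT s t _ => s < B && t < B
  | .query d s => d + 4 < B && s + 3 < B
  | .output s t => s < B && t < B
  | .halt => true

theorem Instr.used_execute_subset {B : ℕ} {i : Instr} (hi : i.Below B = true) {Q : LineOracle}
    {c c' : Config} (h : execute Q c i = some c') (hc : c.used ⊆ Finset.range B) :
    c'.used ⊆ Finset.range B := by
  cases i with
  | query d s =>
    simp only [Instr.Below, Bool.and_eq_true, decide_eq_true_eq] at hi
    simp only [execute] at h
    split_ifs at h
    split at h <;> cases h <;>
    · refine Finset.union_subset hc fun x hx => ?_
      simp only [Finset.mem_insert, Finset.mem_singleton] at hx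
      simp only [Finset.mem_range]
      omega
  | load d s => simp [Instr.Below] at hi
  | store d s => simp [Instr.Below] at hi
  | halt => simp [execute] at h
  | _ =>
    simp only [Instr.Below, Bool.and_eq_true, decide_eq_true_eq] at hi
    simp only [execute] at h
    (try split_ifs at h) <;> cases h <;>
    · refine Finset.union_subset hc fun x hx => ?_
      simp only [Finset.mem_insert, Finset.mem_singleton] at hx
      simp only [Finset.mem_range]
      omega

/-- Without indirect addressing the registers touched are a static property of the program, so space
needs no analysis of the run. -/
theorem used_runFor_subset {B : ℕ} {P : Program} (hP : ∀ i ∈ P, i.Below B = true)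
    {Q : LineOracle} {n : ℕ} {c c' : Config} (h : runFor P Q n c = some c')
    (hc : c.used ⊆ Finset.range B) : c'.used ⊆ Finset.range B := by
  induction n generalizing c with
  | zero => cases h; exact hc
  | succ n ih =>
    simp only [runFor, step, Option.bind_eq_some_iff] at h
    obtain ⟨c1, ⟨i, hi, h1⟩, h2⟩ := h
    exact ih h2 (Instr.used_execute_subset (hP i (List.mem_of_getElem? hi)) h1 hc)

/-! ### Planar integer vectors -/

/-- The determinant of two integer vectors. -/
def det (a b : ℤ × ℤ) : ℤ := a.1 * b.2 - a.2 * b.1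

/-- The scalar product of two integer vectors. -/
def dot (a b : ℤ × ℤ) : ℤ := a.1 * b.1 + a.2 * b.2

/-- Rotation by a right angle, counterclockwise. -/
def rot (a : ℤ × ℤ) : ℤ × ℤ := (-a.2, a.1)

/-- `z` points strictly to the left of `d`, or in the direction opposite to `d`. -/
def LexPos (d z : ℤ × ℤ) : Prop := 0 < det d z ∨ det d z = 0 ∧ dot d z < 0

theorem det_add (a b c : ℤ × ℤ) : det a (b + c) = det a b + det a c := by
  simp only [det, Prod.fst_add, Prod.snd_add]; ring

theorem det_smul (a b : ℤ × ℤ) (k : ℤ) : det a (k • b) = k * det a b := by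
  simp only [det, Prod.smul_fst, Prod.smul_snd, smul_eq_mul]; ring

theorem add_det (a b c : ℤ × ℤ) : det (a + b) c = det a c + det b c := by
  simp only [det, Prod.fst_add, Prod.snd_add]; ring

theorem smul_det (a b : ℤ × ℤ) (k : ℤ) : det (k • a) b = k * det a b := by
  simp only [det, Prod.smul_fst, Prod.smul_snd, smul_eq_mul]; ring

theorem det_self (a : ℤ × ℤ) : det a a = 0 := by simp only [det]; ring

theorem det_swap (a b : ℤ × ℤ) : det a b = -det b a := by simp only [det]; ring

theorem dot_add (a b c : ℤ × ℤ) : dot a (b + c) = dot a b + dot a c := by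
  simp only [dot, Prod.fst_add, Prod.snd_add]; ring

theorem dot_smul (a b : ℤ × ℤ) (k : ℤ) : dot a (k • b) = k * dot a b := by
  simp only [dot, Prod.smul_fst, Prod.smul_snd, smul_eq_mul]; ring

theorem smul_dot (a b : ℤ × ℤ) (k : ℤ) : dot (k • a) b = k * dot a b := by
  simp only [dot, Prod.smul_fst, Prod.smul_snd, smul_eq_mul]; ring

theorem dot_self_pos {a : ℤ × ℤ} (h : a ≠ 0) : 0 < dot a a := by
  obtain ⟨x, y⟩ := a
  simp only [dot]
  by_contra hc
  have hx : x = 0 := by nlinarith [mul_self_nonneg x, mul_self_nonneg y]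
  have hy : y = 0 := by nlinarith [mul_self_nonneg x, mul_self_nonneg y]
  exact h (by simp [hx, hy])

/-- Cramer's rule: in a unimodular basis u, w the coordinates of z are α = `det z w` and β = `det u
z`. The search lemmas compute in these coordinates. -/
theorem eq_smul_add_smul {u w : ℤ × ℤ} (h : det u w = 1) (z : ℤ × ℤ) :
    z = det z w • u + det u z • w := by
  obtain ⟨u1, u2⟩ := u
  obtain ⟨w1, w2⟩ := w
  obtain ⟨z1, z2⟩ := z
  simp only [det] at h
  ext <;> simp only [det, Prod.fst_add, Prod.snd_add, Prod.smul_mk, smul_eq_mul]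
  · linear_combination (-z1) * h
  · linear_combination (-z2) * h

/-- Parallel vectors are proportional. -/
theorem dot_smul_eq_of_det_eq_zero {a b : ℤ × ℤ} (h : det a b = 0) :
    dot a a • b = dot a b • a := by
  obtain ⟨a1, a2⟩ := a
  obtain ⟨b1, b2⟩ := b
  simp only [det] at h
  ext <;> simp only [dot, Prod.smul_mk, smul_eq_mul]
  · linear_combination (-a2) * h
  · linear_combination a1 * h

theorem not_lexPos_zero (d : ℤ × ℤ) : ¬ LexPos d 0 := by simp [LexPos, det, dot]

/-- `LexPos d` is a lexicographically positive half-plane without 0. Closure under positive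
combinations rules out positive linear relations among its members, which is how the vertex property
is exploited. -/
theorem LexPos.add {d a b : ℤ × ℤ} (ha : LexPos d a) (hb : LexPos d b) : LexPos d (a + b) := by
  simp only [LexPos, det_add, dot_add] at *
  omega

theorem LexPos.smul {d a : ℤ × ℤ} {k : ℤ} (hk : 0 < k) (ha : LexPos d a) : LexPos d (k • a) := by
  simp only [LexPos, det_smul, dot_smul] at *
  rcases ha with h | ⟨h, h'⟩
  · exact Or.inl (mul_pos hk h)
  · exact Or.inr ⟨by simp [h], mul_neg_of_pos_of_neg hk h'⟩

theorem LexPos.smul_left {d a : ℤ × ℤ} {k : ℤ} (hk : 0 < k) (ha : LexPos d a) :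
    LexPos (k • d) a := by
  simp only [LexPos, smul_det, smul_dot] at *
  rcases ha with h | ⟨h, h'⟩
  · exact Or.inl (mul_pos hk h)
  · exact Or.inr ⟨by simp [h], mul_neg_of_pos_of_neg hk h'⟩

theorem LexPos.not_neg {d a : ℤ × ℤ} (ha : LexPos d a) : ¬ LexPos d (-a) := fun h =>
  not_lexPos_zero d (by simpa using ha.add h)

/-! ### Lattice-convex sets -/

/-- `S` contains every lattice point in the triangles spanned by its points. -/
def LatConvex (S : Set (ℤ × ℤ)) : Prop :=
  ∀ a ∈ S, ∀ b ∈ S, ∀ c ∈ S, ∀ i j k : ℤ, 0 ≤ i → 0 ≤ j → 0 ≤ k → 0 < i + j + k →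
    ∀ x : ℤ × ℤ, (i + j + k) • x = i • a + j • b + k • c → x ∈ S

/-- The leftover weight n - i - j is put on the apex p, so only the two other corners of the
triangle need to be weighed. -/
theorem LatConvex.add_mem {S : Set (ℤ × ℤ)} (hS : LatConvex S) {p a b x : ℤ × ℤ} (hp : p ∈ S)
    (ha : p + a ∈ S) (hb : p + b ∈ S) {i j n : ℤ} (hi : 0 ≤ i) (hj : 0 ≤ j) (hn : i + j ≤ n)
    (hn0 : 0 < n) (hx : n • x = i • a + j • b) : p + x ∈ S := by
  refine hS _ hp _ ha _ hb (n - i - j) i j (by omega) hi hj (by omega) _ ?_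
  rw [show n - i - j + i + j = n by ring, smul_add, hx]
  module

theorem LatConvex.add_mem_of_smul {S : Set (ℤ × ℤ)} (hS : LatConvex S) {p x : ℤ × ℤ}
    (hp : p ∈ S) {n : ℤ} (hn : 0 < n) (hx : p + n • x ∈ S) : p + x ∈ S :=
  hS.add_mem hp hx hx (i := 1) (j := 0) zero_le_one le_rfl (by omega) hn (by simp)

/-- `p` is a vertex of the convex hull of `S`, as all of `S` lies to the left of the line through
`p` with direction `d`, and on this line behind `p`. -/
def Supp (S : Set (ℤ × ℤ)) (p d : ℤ × ℤ) : Prop :=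
  p ∈ S ∧ ∀ z, p + z ∈ S → z ≠ 0 → LexPos d z

/-- `q` succeeds `p` on the boundary of the convex hull of `S`, in counterclockwise order. -/
def Next (S : Set (ℤ × ℤ)) (p q : ℤ × ℤ) : Prop :=
  p ∈ S ∧ p ≠ q ∧ Supp S q (q - p)

theorem Next.left {S : Set (ℤ × ℤ)} {p q : ℤ × ℤ} (h : Next S p q) {z : ℤ × ℤ} (hz : z ∈ S) :
    0 ≤ det (q - p) (z - q) := by
  by_cases hzq : z = q
  · simp [hzq, det]
  · rcases h.2.2.2 (z - q) (by simpa using hz) (sub_ne_zero.2 hzq) with h | ⟨h, -⟩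
    · exact h.le
    · exact h.ge

/-- A vertex has at most one predecessor that is a vertex. -/
theorem Next.injective {S : Set (ℤ × ℤ)} {p p' q d d' : ℤ × ℤ} (h : Next S p q)
    (h' : Next S p' q) (hp : Supp S p d) (hp' : Supp S p' d') : p = p' := by
  by_contra hne
  obtain ⟨a, rfl⟩ : ∃ a, p = q + a := ⟨p - q, by abel⟩
  obtain ⟨b, rfl⟩ : ∃ b, p' = q + b := ⟨p' - q, by abel⟩
  have hab : a ≠ b := fun h => hne (by rw [h])
  have ha : a ≠ 0 := fun h0 => h.2.1 (by simp [h0])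
  have hb : b ≠ 0 := fun h0 => h'.2.1 (by simp [h0])
  have h1 : LexPos (-a) b := by simpa using h.2.2.2 b h'.1 hb
  have h2 : LexPos (-b) a := by simpa using h'.2.2.2 a h.1 ha
  -- Each predecessor is weakly to the left of the edge from the other one. The two determinants
  -- have opposite signs, hence vanish, and a, b point along one ray from q.
  have h3 : det a b = 0 ∧ 0 < dot a b := by
    simp only [LexPos, det, dot, Prod.fst_neg, Prod.snd_neg] at h1 h2 ⊢
    constructor
    · rcases h1 with h1 | h1 <;> rcases h2 with h2 | h2 <;> linarith
    · rcases h1 with h1 | h1 <;> rcases h2 with h2 | h2 <;> linarith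
  obtain ⟨h3, h4⟩ := h3
  have h5 : det b a = 0 := by rw [det_swap, h3, neg_zero]
  have h6 : dot b a = dot a b := by simp only [dot]; ring
  have hq := h.2.2.1
  have l1 : LexPos d (-a) := hp.2 (-a) (by simpa using hq) (neg_ne_zero.2 ha)
  have l2 : LexPos d (b - a) := hp.2 (b - a) (by simpa using h'.1) (sub_ne_zero.2 hab.symm)
  have l3 : LexPos d' (-b) := hp'.2 (-b) (by simpa using hq) (neg_ne_zero.2 hb)
  have l4 : LexPos d' (a - b) := hp'.2 (a - b) (by simpa using h.1) (sub_ne_zero.2 hab)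
  have ea := dot_smul_eq_of_det_eq_zero h3
  have eb := dot_smul_eq_of_det_eq_zero h5
  have pa := dot_self_pos ha
  have pb := dot_self_pos hb
  have ea' : dot a a • (b - a) = (dot a a - dot a b) • (-a) := by rw [smul_sub, ea]; module
  have eb' : dot b b • (a - b) = (dot b b - dot a b) • (-b) := by rw [smul_sub, eb, h6]; module
  -- The nearer of the two points on the ray lies strictly between q and the other, so it cannot be
  -- a vertex.
  rcases lt_trichotomy (dot a b) (dot a a) with hlt | heq | hgt
  · have h7 : dot a b * dot a b = dot a a * dot b b := by
      have : dot a b * dot a b + det a b * det a b = dot a a * dot b b := by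
        simp only [dot, det]; ring
      rw [← this, h3]; ring
    have h8 : dot b b < dot a b := by nlinarith
    have l5 := LexPos.smul pb l4
    rw [eb', ← neg_neg ((dot b b - dot a b) • (-b)), ← neg_smul, neg_sub] at l5
    exact (LexPos.smul (sub_pos.2 h8) l3).not_neg l5
  · have : dot a a • (b - a) = 0 := by rw [ea', heq]; simp
    exact hab.symm (sub_eq_zero.1 ((smul_eq_zero.1 this).resolve_left pa.ne'))
  · have l5 := LexPos.smul pa l2
    rw [ea', ← neg_neg ((dot a a - dot a b) • (-a)), ← neg_smul, neg_sub] at l5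
    exact (LexPos.smul (sub_pos.2 hgt) l1).not_neg l5

/-! ### Search for the direction of the next edge -/

/-- `u`, `w` is a basis of the lattice with `p + w ∈ S` and `p + u ∉ S`, the points of `S` to the
right of the ray from `p` with direction `w` are to the left of the ray with direction `u`, and
both directions are to the left of `u₀`. -/
structure SearchInv (S : Set (ℤ × ℤ)) (p u₀ u w : ℤ × ℤ) : Prop where
  det_eq : det u w = 1
  mem : p + w ∈ S
  not_mem : p + u ∉ S
  left : ∀ z, p + z ∈ S → 0 < det z w → 0 < det u z
  nonneg : 0 ≤ det u₀ u
  pos : 0 < det u₀ w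

namespace SearchInv

variable {S : Set (ℤ × ℤ)} {p d u₀ u w : ℤ × ℤ}

theorem right_ne_zero (h : SearchInv S p u₀ u w) : w ≠ 0 := by
  rintro rfl
  simpa [det] using h.pos

/-- A point z violating the new `left` has α ≤ 0 by the old one, and then a·z + (α - aβ)·w + (-α)·(w
+ a·u) = 0 with nonnegative coefficients, the first two positive. Thus p would be a convex
combination of other points of S, against its being a vertex. -/
theorem advance_right (h : SearchInv S p u₀ u w) (hd : Supp S p d) {a : ℤ} (ha : 0 ≤ a)
    (hm : p + (w + a • u) ∈ S) : SearchInv S p u₀ u (w + a • u) where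
  det_eq := by rw [det_add, det_smul, det_self, h.det_eq]; ring
  mem := hm
  not_mem := h.not_mem
  left := fun z hz hzw => by
    rw [det_add, det_smul, det_swap z u] at hzw
    by_contra hβ
    have hα : det z w ≤ 0 := not_lt.1 fun hα => hβ (h.left z hz hα)
    have haβ : a * det u z < 0 := by linarith
    have hβ0 : det u z < 0 := by nlinarith
    have ha0 : 0 < a := by nlinarith
    have hz0 : z ≠ 0 := by rintro rfl; simp [det] at hβ0
    have l1 := LexPos.smul ha0 (hd.2 z hz hz0)
    have l2 := LexPos.smul (k := det z w - a * det u z) (by linarith)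
      (hd.2 w h.mem h.right_ne_zero)
    have e : a • z + (det z w - a * det u z) • w = -((-det z w) • (w + a • u)) := by
      have := eq_smul_add_smul h.det_eq z
      generalize det z w = α at *
      generalize det u z = β at *
      rw [this]
      module
    rcases hα.eq_or_lt with h0 | h0
    · have := l1.add l2
      rw [e, h0] at this
      exact not_lexPos_zero d (by simpa using this)
    · have hne : w + a • u ≠ 0 := by
        intro h0
        have : det u (w + a • u) = 0 := by rw [h0]; simp [det]
        rw [det_add, det_smul, det_self, h.det_eq] at this
        omega
      exact (LexPos.smul (neg_pos.2 h0) (hd.2 _ hm hne)).not_neg (e ▸ l1.add l2)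
  nonneg := h.nonneg
  pos := by
    rw [det_add, det_smul]
    have := mul_nonneg ha h.nonneg
    linarith [h.pos]

/-- A point z violating the new `left` would put the excluded point p + u + cw into the triangle of
p, p + z and p + u + (c+1)w. -/
theorem advance_left (h : SearchInv S p u₀ u w) (hS : LatConvex S) (hp : p ∈ S) {c : ℤ}
    (hc : 0 ≤ c) (hm : p + (u + (c + 1) • w) ∈ S) (hn : p + (u + c • w) ∉ S) :
    SearchInv S p u₀ (u + c • w) w where
  det_eq := by rw [add_det, smul_det, det_self, h.det_eq]; ring
  mem := h.mem
  not_mem := hn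
  left := fun z hz hzw => by
    have hβ := h.left z hz hzw
    rw [add_det, smul_det, det_swap w z]
    by_contra hcon
    refine hn (hS.add_mem hp hz hm (i := 1) (j := det z w * (c + 1) - det u z - det z w)
      (n := det z w * (c + 1) - det u z) zero_le_one (by linarith) (by linarith)
      (by linarith) ?_)
    have := eq_smul_add_smul h.det_eq z
    generalize det z w = α at *
    generalize det u z = β at *
    rw [this]
    module
  nonneg := by
    rw [det_add, det_smul]
    have := mul_nonneg hc h.pos.le
    linarith [h.nonneg]
  pos := h.pos

/-- For a point z to the right of w, the triangle of p, p + w, p + z cuts the line p + u + sw in the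
interval of s from β/α to (β + α - 1)/α. This always contains an integer, namely β/α rounded up, and
it is nonnegative. -/
theorem left_of_forall_not_mem (h : SearchInv S p u₀ u w) (hS : LatConvex S) (hp : p ∈ S)
    (hn : ∀ s : ℤ, 0 ≤ s → p + (u + s • w) ∉ S) {z : ℤ × ℤ} (hz : p + z ∈ S) :
    0 ≤ det w z := by
  rw [det_swap]
  by_contra hcon
  have hα : 0 < det z w := by linarith
  have hβ := h.left z hz hα
  have e := eq_smul_add_smul h.det_eq z
  generalize det z w = α at *
  generalize det u z = β at *
  have hr := Int.emod_nonneg β hα.ne'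
  have hr' := Int.emod_lt_of_pos β hα
  have hdm := Int.mul_ediv_add_emod β α
  have hm := Int.ediv_nonneg hβ.le hα.le
  generalize β / α = m at *
  generalize β % α = t at *
  rcases hr.eq_or_lt with h0 | h0
  · refine hn m hm (hS.add_mem_of_smul hp hα ?_)
    convert hz using 1
    rw [e, ← hdm, ← h0]
    module
  · refine hn (m + 1) (by omega) (hS.add_mem hp hz h.mem (i := 1) (j := α - t) (n := α)
      zero_le_one (by linarith) (by omega) hα ?_)
    rw [e, ← hdm]
    module

/-- Since w belongs to a lattice basis, every lattice point of the supporting line is p + tw with t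
an integer; the largest t is therefore the end of the edge. -/
theorem supp_of_left (h : SearchInv S p u₀ u w) (hl : ∀ z, p + z ∈ S → 0 ≤ det w z) {k : ℤ}
    (hk : p + k • w ∈ S) (hmax : ∀ t : ℤ, p + t • w ∈ S → t ≤ k) :
    Supp S (p + k • w) w := by
  refine ⟨hk, fun z hz hz0 => ?_⟩
  rw [add_assoc] at hz
  have h1 := hl _ hz
  rw [det_add, det_smul, det_self, mul_zero, zero_add] at h1
  rcases h1.lt_or_eq with h2 | h2
  · exact Or.inl h2
  · refine Or.inr ⟨h2.symm, ?_⟩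
    have e := eq_smul_add_smul h.det_eq z
    rw [det_swap z w, ← h2, neg_zero, zero_smul, zero_add] at e
    have h3 := hmax (k + det u z) (by rw [add_smul, ← e]; exact hz)
    have h4 : det u z ≠ 0 := fun h0 => hz0 (by rw [e, h0, zero_smul])
    rw [e, dot_smul]
    exact mul_neg_of_neg_of_pos (by omega) (dot_self_pos h.right_ne_zero)

end SearchInv

/-! ### Lattice-connected sets -/

theorem latticeGraph_adj_iff {p q : ℤ × ℤ} :
    latticeGraph.Adj p q ↔ (p.1 - q.1) ^ 2 + (p.2 - q.2) ^ 2 = 1 := by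
  change dist (latticePoint p) (latticePoint q) = 1 ↔ _
  rw [EuclideanSpace.dist_eq, Real.sqrt_eq_one]
  simp only [latticePoint, Fin.sum_univ_two, Real.dist_eq, sq_abs, PiLp.toLp_apply,
    Matrix.cons_val_zero, Matrix.cons_val_one]
  norm_cast

theorem latticeGraph_adj_cases {p q : ℤ × ℤ} (h : latticeGraph.Adj p q) :
    q = p + (1, 0) ∨ q = p + (-1, 0) ∨ q = p + (0, 1) ∨ q = p + (0, -1) := by
  rw [latticeGraph_adj_iff] at h
  obtain ⟨a, b⟩ := p
  obtain ⟨c, d⟩ := q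
  simp only [Prod.mk_add_mk, Prod.mk.injEq] at *
  have h1 : a - c ≤ 1 := by nlinarith
  have h2 : -1 ≤ a - c := by nlinarith
  have h3 : b - d ≤ 1 := by nlinarith
  have h4 : -1 ≤ b - d := by nlinarith
  obtain ⟨e, rfl⟩ : ∃ e, a = c + e := ⟨a - c, by ring⟩
  obtain ⟨f, rfl⟩ : ∃ f, b = d + f := ⟨b - d, by ring⟩
  simp only [add_sub_cancel_left] at *
  interval_cases e <;> interval_cases f <;> simp at h ⊢

theorem LatticeConnected.induction {S : Set (ℤ × ℤ)} (h : LatticeConnected S)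
    (A : ℤ × ℤ → Prop) (hA : ∀ z ∈ S, A z → ∀ e ∈ ({(1, 0), (-1, 0), (0, 1), (0, -1)} :
      Set (ℤ × ℤ)), z + e ∈ S → A (z + e)) {p q : ℤ × ℤ} (hp : p ∈ S) (hq : q ∈ S) (hAp : A p) :
    A q := by
  obtain ⟨W⟩ := h.preconnected ⟨p, hp⟩ ⟨q, hq⟩
  suffices ∀ x y : S, (latticeGraph.induce S).Walk x y → A x → A y from this _ _ W hAp
  intro x y W
  induction W with
  | nil => exact id
  | @cons x y z hxy _ ih =>
    intro hx
    apply ih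
    have hadj : latticeGraph.Adj x y := hxy
    have hy := y.2
    rcases latticeGraph_adj_cases hadj with h | h | h | h <;>
    · rw [h] at hy ⊢
      exact hA x x.2 hx _ (by simp) hy

/-- The four unit vectors of the lattice. -/
def IsAxis (a : ℤ × ℤ) : Prop := a = (1, 0) ∨ a = (0, 1) ∨ a = (-1, 0) ∨ a = (0, -1)

theorem IsAxis.rot {a : ℤ × ℤ} (h : IsAxis a) : IsAxis (rot a) := by
  rcases h with rfl | rfl | rfl | rfl <;> simp [IsAxis, _root_.rot]

theorem IsAxis.det_rot {a : ℤ × ℤ} (h : IsAxis a) : det a (_root_.rot a) = 1 := by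
  rcases h with rfl | rfl | rfl | rfl <;> simp [det, _root_.rot]

theorem IsAxis.ne_zero {a : ℤ × ℤ} (h : IsAxis a) : a ≠ 0 := by
  rcases h with rfl | rfl | rfl | rfl <;> simp

/-- The quadrant between two directions in which `p` has no neighbour in `S` contains no point
of `S`. -/
theorem LatticeConnected.quadrant {S : Set (ℤ × ℤ)} (hc : LatticeConnected S)
    (hS : LatConvex S) {p u : ℤ × ℤ} (hp : p ∈ S) (hu : IsAxis u) (h1 : p + u ∉ S)
    (h2 : p + -rot u ∉ S) {z : ℤ × ℤ} (hz : p + z ∈ S) (hα : 0 < det z (rot u)) :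
    0 < det u z := by
  by_contra hβ
  have key := hc.induction (fun q => 0 < det (q - p) (rot u) ∧ det u (q - p) < 0) ?_ hz hp ?_
  · simp [det] at key
  · rintro y hy ⟨ha, hb⟩ e he hye
    have hα : 0 < det (y + e - p) (rot u) ∨ det (y + e - p) (rot u) = 0 := by
      rcases hu with rfl | rfl | rfl | rfl <;> rcases he with rfl | rfl | rfl | rfl <;>
        simp [det, rot] at * <;> omega
    have hβ : det u (y + e - p) < 0 ∨ det u (y + e - p) = 0 := by
      rcases hu with rfl | rfl | rfl | rfl <;> rcases he with rfl | rfl | rfl | rfl <;>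
        simp [det, rot] at * <;> omega
    -- A unit step changes only one of the two coordinates, so the path cannot jump from the open
    -- quadrant directly to p.
    have hab : ¬ (det (y + e - p) (rot u) = 0 ∧ det u (y + e - p) = 0) := by
      rcases hu with rfl | rfl | rfl | rfl <;> rcases he with rfl | rfl | rfl | rfl <;>
        simp [det, rot] at * <;> omega
    have ed := eq_smul_add_smul hu.det_rot (y + e - p)
    have hye' : p + (y + e - p) ∈ S := by simpa using hye
    refine ⟨hα.resolve_right fun h0 => h2 ?_, hβ.resolve_right fun h0 => h1 ?_⟩
    · refine hS.add_mem_of_smul hp (n := -det u (y + e - p)) (by omega) ?_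
      convert hye' using 2
      nth_rw 2 [ed]
      rw [h0]
      module
    · refine hS.add_mem_of_smul hp (n := det (y + e - p) (rot u)) (by omega) ?_
      convert hye' using 2
      nth_rw 2 [ed]
      rw [h0]
      module
  · rw [add_sub_cancel_left]
    refine ⟨hα, (not_lt.1 hβ).lt_of_ne fun h0 => h1 ?_⟩
    refine hS.add_mem_of_smul hp hα ?_
    convert hz using 2
    nth_rw 2 [eq_smul_add_smul hu.det_rot z]
    rw [h0]
    module

theorem LatticeConnected.eq_of_forall_axis {S : Set (ℤ × ℤ)} (hc : LatticeConnected S)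
    {p : ℤ × ℤ} (hp : p ∈ S) (h : ∀ a, IsAxis a → p + a ∉ S) {z : ℤ × ℤ} (hz : z ∈ S) : z = p := by
  refine hc.induction (fun q => q = p) ?_ hp hz rfl
  rintro y - rfl e he hye
  refine absurd hye (h e ?_)
  rcases he with rfl | rfl | rfl | rfl <;> simp [IsAxis]

/-- The search starts with the first axis direction, in counterclockwise order, in which `p` has
a neighbour. -/
theorem SearchInv.init {S : Set (ℤ × ℤ)} (hc : LatticeConnected S) (hS : LatConvex S)
    {p d u : ℤ × ℤ} (hd : Supp S p d) (hu : IsAxis u) (h1 : p + u ∉ S) (h2 : p + rot u ∈ S) :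
    SearchInv S p u u (rot u) where
  det_eq := hu.det_rot
  mem := h2
  not_mem := h1
  -- The neighbour opposite to p + `rot u` is missing because a vertex is not the midpoint of two
  -- points of S.
  left := fun _ hz hα => hc.quadrant hS hd.1 hu h1 (fun h3 =>
    (hd.2 _ h2 hu.rot.ne_zero).not_neg (hd.2 _ h3 (neg_ne_zero.2 hu.rot.ne_zero))) hz hα
  nonneg := (det_self u).ge
  pos := by rw [hu.det_rot]; exact zero_lt_one

/-- If a row below `p` is free of points of `S`, then all of `S` is above it. -/
theorem LatticeConnected.row {S : Set (ℤ × ℤ)} (hc : LatticeConnected S) {p : ℤ × ℤ} (hp : p ∈ S)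
    {y : ℤ} (hy : y < p.2) (hrow : ∀ x, (x, y) ∉ S) {z : ℤ × ℤ} (hz : z ∈ S) : y < z.2 := by
  refine hc.induction (fun q => y < q.2) ?_ hp hz hy
  rintro ⟨a, b⟩ - hb e he hye
  have : b + e.2 ≠ y := fun h0 => hrow (a + e.1) (by rw [← h0]; exact hye)
  rcases he with rfl | rfl | rfl | rfl <;> simp at * <;> omega

/-- The last point of the lowest row is a vertex. -/
theorem supp_of_row {S : Set (ℤ × ℤ)} (hc : LatticeConnected S) {p : ℤ × ℤ} (hp : p ∈ S)
    (hrow : ∀ x, (x, p.2 - 1) ∉ S) (hmax : ∀ t : ℤ, p + t • (1, 0) ∈ S → t ≤ 0) :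
    Supp S p (1, 0) := by
  refine ⟨hp, fun z hz hz0 => ?_⟩
  have h1 := hc.row hp (by omega) hrow hz
  obtain ⟨a, b⟩ := z
  simp only [LexPos, det, dot, Prod.snd_add] at *
  rcases (show 0 ≤ b by omega).lt_or_eq with hb | rfl
  · left; omega
  · right
    have := hmax a (by simpa using hz)
    have : a ≠ 0 := by rintro rfl; exact hz0 rfl
    omega

/-! ### The discrete hull -/

theorem latticePoint_zero (p : ℤ × ℤ) : latticePoint p 0 = p.1 := rfl

theorem latticePoint_one (p : ℤ × ℤ) : latticePoint p 1 = p.2 := rfl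

theorem plane_ext {x y : Plane} (h0 : x 0 = y 0) (h1 : x 1 = y 1) : x = y := by
  ext i
  fin_cases i <;> assumption

theorem latticePoint_injective : Function.Injective latticePoint := by
  intro p q h
  have h0 := congrArg (fun x : Plane => x 0) h
  have h1 := congrArg (fun x : Plane => x 1) h
  simp only [latticePoint_zero, latticePoint_one, Int.cast_inj] at h0 h1
  exact Prod.ext h0 h1

theorem latticePoint_add (p q : ℤ × ℤ) :
    latticePoint (p + q) = latticePoint p + latticePoint q := by
  apply plane_ext <;>
    simp [latticePoint_zero, latticePoint_one, PiLp.add_apply]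

theorem latticePoint_smul (k : ℤ) (p : ℤ × ℤ) :
    latticePoint (k • p) = (k : ℝ) • latticePoint p := by
  apply plane_ext <;>
    simp [latticePoint_zero, latticePoint_one, PiLp.smul_apply]

theorem latConvex_integerPoints {C : Set Plane} (hC : Convex ℝ C) :
    LatConvex (integerPoints C) := by
  intro a ha b hb c hc i j k hi hj hk hn x hx
  have hn' : (0 : ℝ) < i + j + k := by exact_mod_cast hn
  have hx' := congrArg latticePoint hx
  simp only [latticePoint_add, latticePoint_smul, Int.cast_add] at hx'
  have hx2 : latticePoint x = ((i : ℝ) / (i + j + k)) • latticePoint a +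
      ((j : ℝ) / (i + j + k)) • latticePoint b + ((k : ℝ) / (i + j + k)) • latticePoint c := by
    have := congrArg (fun y => ((i : ℝ) + j + k)⁻¹ • y) hx'
    simp only [smul_smul, inv_mul_cancel₀ hn'.ne', one_smul, smul_add] at this
    simpa only [div_eq_inv_mul] using this
  have := hC.sum_mem (t := Finset.univ)
    (w := ![(i : ℝ) / (i + j + k), (j : ℝ) / (i + j + k), (k : ℝ) / (i + j + k)])
    (z := ![latticePoint a, latticePoint b, latticePoint c]) ?_ ?_ ?_
  · rw [integerPoints, Set.mem_ofPred_eq, hx2]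
    simpa [Fin.sum_univ_three] using this
  · intro m _
    have : (0 : ℝ) ≤ i := by exact_mod_cast hi
    have : (0 : ℝ) ≤ j := by exact_mod_cast hj
    have : (0 : ℝ) ≤ k := by exact_mod_cast hk
    fin_cases m <;> simp <;> positivity
  · simp only [Fin.sum_univ_three, Matrix.cons_val_zero, Matrix.cons_val_one, Matrix.cons_val]
    field_simp
  · intro m _
    fin_cases m
    exacts [ha, hb, hc]

theorem discreteHull_eq (C : Set Plane) :
    discreteHull C = convexHull ℝ (latticePoint '' integerPoints C) := by
  rw [discreteHull]
  congr 1
  ext x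
  constructor
  · rintro ⟨h, p, rfl⟩
    exact ⟨p, h, rfl⟩
  · rintro ⟨p, h, rfl⟩
    exact ⟨h, p, rfl⟩

theorem cross_latticePoint (p q z : ℤ × ℤ) :
    cross (latticePoint p) (latticePoint q) (latticePoint z) = (det (q - p) (z - p) : ℤ) := by
  simp [cross, det, latticePoint_zero, latticePoint_one]

theorem convex_setOf_cross_nonneg (p q : Plane) : Convex ℝ {z | 0 ≤ cross p q z} := by
  intro x hx y hy a b ha hb hab
  simp only [Set.mem_ofPred_eq, cross, PiLp.add_apply, PiLp.smul_apply, smul_eq_mul] at *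
  have := add_nonneg (mul_nonneg ha hx) (mul_nonneg hb hy)
  obtain rfl : b = 1 - a := by linarith
  linarith

theorem Next.cross_nonneg {S : Set (ℤ × ℤ)} {p q : ℤ × ℤ} (h : Next S p q) {z : Plane}
    (hz : z ∈ convexHull ℝ (latticePoint '' S)) :
    0 ≤ cross (latticePoint p) (latticePoint q) z := by
  refine convexHull_min ?_ (convex_setOf_cross_nonneg _ _) hz
  rintro _ ⟨y, hy, rfl⟩
  rw [Set.mem_ofPred_eq, cross_latticePoint, Int.cast_nonneg_iff]
  have := h.left hy
  rwa [show y - p = (y - q) + (q - p) by abel, det_add, det_self, add_zero]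

/-- The hull lies in the convex set H, where the form `det d` is positive, or zero with `dot d`
nonpositive (relative to p). If p is inside a segment of H, first the one form and then the other
must vanish at both ends; as d ≠ 0, the two forms determine the point. -/
theorem Supp.mem_extremePoints_of_ne_zero {S : Set (ℤ × ℤ)} {p d : ℤ × ℤ} (h : Supp S p d)
    (hd : d ≠ 0) : latticePoint p ∈ (convexHull ℝ (latticePoint '' S)).extremePoints ℝ := by
  obtain ⟨p1, p2⟩ := p
  obtain ⟨d1, d2⟩ := d
  let H : Set Plane := {x | 0 < (d1 : ℝ) * (x 1 - p2) - d2 * (x 0 - p1) ∨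
    (d1 : ℝ) * (x 1 - p2) - d2 * (x 0 - p1) = 0 ∧ d1 * (x 0 - p1) + d2 * (x 1 - p2) ≤ 0}
  have hH : convexHull ℝ (latticePoint '' S) ⊆ H := by
    refine convexHull_min ?_ ?_
    · rintro _ ⟨⟨y1, y2⟩, hy, rfl⟩
      simp only [H, Set.mem_ofPred_eq, latticePoint_zero, latticePoint_one]
      by_cases h0 : (y1 - p1, y2 - p2) = (0 : ℤ × ℤ)
      · simp only [Prod.mk_eq_zero] at h0
        obtain rfl : y1 = p1 := by omega
        obtain rfl : y2 = p2 := by omega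
        simp
      · have := h.2 (y1 - p1, y2 - p2) (by simpa using hy) h0
        simp only [LexPos, det, dot] at this
        exact_mod_cast this.imp id (And.imp id le_of_lt)
    · intro x hx y hy a b ha hb hab
      simp only [H, Set.mem_ofPred_eq, PiLp.add_apply, PiLp.smul_apply, smul_eq_mul] at *
      obtain rfl : b = 1 - a := by linarith
      have e1 : (d1 : ℝ) * (a * x 1 + (1 - a) * y 1 - p2) - d2 * (a * x 0 + (1 - a) * y 0 - p1) =
        a * (d1 * (x 1 - p2) - d2 * (x 0 - p1)) +
          (1 - a) * (d1 * (y 1 - p2) - d2 * (y 0 - p1)) := by ring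
      have e2 : (d1 : ℝ) * (a * x 0 + (1 - a) * y 0 - p1) + d2 * (a * x 1 + (1 - a) * y 1 - p2) =
        a * (d1 * (x 0 - p1) + d2 * (x 1 - p2)) +
          (1 - a) * (d1 * (y 0 - p1) + d2 * (y 1 - p2)) := by ring
      rw [e1, e2]
      generalize (d1 : ℝ) * (x 1 - p2) - d2 * (x 0 - p1) = f at *
      generalize (d1 : ℝ) * (y 1 - p2) - d2 * (y 0 - p1) = f' at *
      generalize (d1 : ℝ) * (x 0 - p1) + d2 * (x 1 - p2) = g at *
      generalize (d1 : ℝ) * (y 0 - p1) + d2 * (y 1 - p2) = g' at *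
      rcases ha.eq_or_lt with rfl | ha
      · simpa using hy
      rcases hb.eq_or_lt with hb | hb
      · obtain rfl : a = 1 := by linarith
        simpa using hx
      rcases hx with hx | ⟨rfl, hx⟩
      · left
        have : 0 ≤ f' := by rcases hy with hy | hy <;> linarith
        positivity
      · rcases hy with hy | ⟨rfl, hy⟩
        · left
          positivity
        · right
          exact ⟨by ring, by nlinarith⟩
  refine mem_extremePoints.2 ⟨subset_convexHull ℝ _ ⟨_, h.1, rfl⟩, fun x hx y hy hxy => ?_⟩
  obtain ⟨a, b, ha, hb, hab, he⟩ := hxy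
  have h0 := congrArg (fun x : Plane => x 0) he
  have h1 := congrArg (fun x : Plane => x 1) he
  simp only [PiLp.add_apply, PiLp.smul_apply, smul_eq_mul, latticePoint_zero,
    latticePoint_one] at h0 h1
  obtain rfl : b = 1 - a := by linarith
  have hx' := hH hx
  have hy' := hH hy
  simp only [H, Set.mem_ofPred_eq] at hx' hy'
  have e1 : a * ((d1 : ℝ) * (x 1 - p2) - d2 * (x 0 - p1)) +
          (1 - a) * (d1 * (y 1 - p2) - d2 * (y 0 - p1)) = 0 := by
    linear_combination d1 * h1 - d2 * h0
  have e2 : a * ((d1 : ℝ) * (x 0 - p1) + d2 * (x 1 - p2)) +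
          (1 - a) * (d1 * (y 0 - p1) + d2 * (y 1 - p2)) = 0 := by
    linear_combination d1 * h0 + d2 * h1
  have hd' : 0 < (d1 : ℝ) ^ 2 + (d2 : ℝ) ^ 2 := by
    have := dot_self_pos hd
    simp only [dot, ← sq] at this
    exact_mod_cast this
  have key : ∀ s t : ℝ, (d1 : ℝ) * t - d2 * s = 0 → d1 * s + d2 * t = 0 → s = 0 ∧ t = 0 := by
    intro s t h1 h2
    constructor
    · refine (mul_eq_zero.1 (?_ : ((d1 : ℝ) ^ 2 + (d2 : ℝ) ^ 2) * s = 0)).resolve_left hd'.ne'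
      linear_combination d1 * h2 - d2 * h1
    · refine (mul_eq_zero.1 (?_ : ((d1 : ℝ) ^ 2 + (d2 : ℝ) ^ 2) * t = 0)).resolve_left hd'.ne'
      linear_combination d1 * h1 + d2 * h2
  have fin : (x 0 - p1 = 0 ∧ x 1 - p2 = 0) ∧ (y 0 - p1 = 0 ∧ y 1 - p2 = 0) := by
    have kx := key (x 0 - p1) (x 1 - p2)
    have ky := key (y 0 - p1) (y 1 - p2)
    generalize (d1 : ℝ) * (x 1 - p2) - d2 * (x 0 - p1) = f at *
    generalize (d1 : ℝ) * (y 1 - p2) - d2 * (y 0 - p1) = f' at *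
    generalize (d1 : ℝ) * (x 0 - p1) + d2 * (x 1 - p2) = g at *
    generalize (d1 : ℝ) * (y 0 - p1) + d2 * (y 1 - p2) = g' at *
    have hf : 0 ≤ f := by rcases hx' with hx | hx <;> linarith
    have hf' : 0 ≤ f' := by rcases hy' with hx | hx <;> linarith
    have f0 : f = 0 := by nlinarith [mul_nonneg ha.le hf, mul_nonneg hb.le hf']
    have f0' : f' = 0 := by nlinarith [mul_nonneg ha.le hf, mul_nonneg hb.le hf']
    have hg : g ≤ 0 := by rcases hx' with hx | hx <;> linarith
    have hg' : g' ≤ 0 := by rcases hy' with hx | hx <;> linarith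
    have g0 : g = 0 := by
      nlinarith [mul_nonneg ha.le (neg_nonneg.2 hg), mul_nonneg hb.le (neg_nonneg.2 hg')]
    have g0' : g' = 0 := by
      nlinarith [mul_nonneg ha.le (neg_nonneg.2 hg), mul_nonneg hb.le (neg_nonneg.2 hg')]
    exact ⟨kx f0 g0, ky f0' g0'⟩
  obtain ⟨⟨k1, k2⟩, k3, k4⟩ := fin
  constructor <;> apply plane_ext <;> simp only [latticePoint_zero, latticePoint_one] <;> linarith

theorem Supp.mem_extremePoints {S : Set (ℤ × ℤ)} {p d : ℤ × ℤ} (h : Supp S p d) :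
    latticePoint p ∈ (convexHull ℝ (latticePoint '' S)).extremePoints ℝ := by
  by_cases hd : d = 0
  -- `LexPos 0` holds for no vector, so here S has p as its only point and any direction serves.
  · refine Supp.mem_extremePoints_of_ne_zero (d := (1, 0)) ⟨h.1, fun z hz hz0 => ?_⟩ (by simp)
    have := h.2 z hz hz0
    simp [hd, LexPos, det, dot] at this
  · exact h.mem_extremePoints_of_ne_zero hd

/-- `S` is contained in the angle at `q` between the edges to the neighbouring vertices. -/
theorem Next.wedge {S : Set (ℤ × ℤ)} {p q r z : ℤ × ℤ} (h : Next S p q) (h' : Next S q r)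
    (hz : z ∈ S) : ∃ a b c : ℤ, 0 ≤ a ∧ 0 ≤ b ∧ 0 < c ∧
      c • (z - q) = a • (r - q) + b • (p - q) := by
  have hA : r - q ≠ 0 := sub_ne_zero.2 h'.2.1.symm
  have hE1 := h.left hz
  have hE2 := h'.left hz
  have hD := h'.left h.1
  rw [show z - r = (z - q) + (-1 : ℤ) • (r - q) by module, det_add, det_smul, det_self, mul_zero,
    add_zero] at hE2
  rw [show p - r = (p - q) + (-1 : ℤ) • (r - q) by module, det_add, det_smul, det_self, mul_zero,
    add_zero] at hD
  rw [show q - p = (-1 : ℤ) • (p - q) by module, smul_det] at hE1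
  have h3 := h.2.2.2 (r - q) (by simpa using h'.2.2.1) hA
  have h4 := h.2.2.2 (z - q) (by simpa using hz)
  rw [show q - p = (-1 : ℤ) • (p - q) by module] at h3 h4
  simp only [LexPos, smul_det, smul_dot] at h3 h4
  generalize r - q = A at *
  generalize p - q = B at *
  generalize z - q = E at *
  -- If the two edges span a proper angle, Cramer's rule gives the coefficients. Otherwise they are
  -- parallel and point the same way, the hull is a segment ending at q, and the coefficient along r
  -- - q suffices.
  rcases hD.lt_or_eq with hD | hD
  · refine ⟨det E B, det A E, det A B, by rw [det_swap]; linarith, hE2, hD, ?_⟩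
    ext <;> simp only [det, Prod.smul_fst, Prod.smul_snd, smul_eq_mul, Prod.fst_add,
      Prod.snd_add] <;> ring
  · have hBA : det B A = 0 := by rw [det_swap]; omega
    have hdot : 0 < dot B A := by omega
    have hB : dot A A • B = dot B A • A := by
      rw [dot_smul_eq_of_det_eq_zero hD.symm]
      congr 1
      simp only [dot]; ring
    have hAA := dot_self_pos hA
    have e1 : dot A A * det B E = dot B A * det A E := by
      rw [← smul_det, ← smul_det, hB]
    have e2 : dot A A * dot B E = dot B A * dot A E := by
      rw [← smul_dot, ← smul_dot, hB]
    have hAE : det A E = 0 := by nlinarith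
    have hBE : det B E = 0 := by
      rw [hAE, mul_zero] at e1
      exact (mul_eq_zero.1 e1).resolve_left hAA.ne'
    refine ⟨dot A E, 0, dot A A, ?_, le_rfl, hAA, ?_⟩
    · by_cases hE : E = 0
      · simp [hE, dot]
      · have := h4 hE
        rw [hBE] at this
        have : 0 < dot B E := by omega
        by_contra hc
        nlinarith
    · rw [dot_smul_eq_of_det_eq_zero hAE]
      simp

/-- A closed polygon of boundary edges passes through all vertices. -/
theorem subset_convexHull_of_next {S : Set (ℤ × ℤ)} {F : Finset (ℤ × ℤ)} (hF : F.Nonempty)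
    (hpred : ∀ q ∈ F, ∃ p ∈ F, Next S p q) (hsucc : ∀ q ∈ F, ∃ r ∈ F, Next S q r) :
    latticePoint '' S ⊆ convexHull ℝ (latticePoint '' F) := by
  rintro _ ⟨z, hz, rfl⟩
  by_contra hcon
  obtain ⟨f, u, hf, hu⟩ := geometric_hahn_banach_closed_point (convex_convexHull ℝ _)
    ((F.finite_toSet.image latticePoint).isClosed_convexHull (𝕜 := ℝ)) hcon
  obtain ⟨q, hq, hmax⟩ := F.exists_max_image (fun q => f (latticePoint q)) hF
  obtain ⟨p, hp, hpq⟩ := hpred q hq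
  obtain ⟨r, hr, hqr⟩ := hsucc q hq
  obtain ⟨a, b, c, ha, hb, hc, he⟩ := hpq.wedge hqr hz
  have hsub : ∀ x y : ℤ × ℤ, latticePoint (x - y) = latticePoint x - latticePoint y :=
    fun x y => by rw [eq_sub_iff_add_eq, ← latticePoint_add, sub_add_cancel]
  have he' := congrArg (fun x => f (latticePoint x)) he
  simp only [latticePoint_add, latticePoint_smul, hsub, map_add, map_smul, map_sub,
    smul_eq_mul] at he'
  have h1 := hmax p hp
  have h2 := hmax r hr
  have h3 := hf _ (subset_convexHull ℝ _ ⟨q, hq, rfl⟩)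
  have ha' : (0 : ℝ) ≤ a := by exact_mod_cast ha
  have hb' : (0 : ℝ) ≤ b := by exact_mod_cast hb
  have hc' : (0 : ℝ) < c := by exact_mod_cast hc
  nlinarith [mul_nonneg ha' (sub_nonneg.2 h2), mul_nonneg hb' (sub_nonneg.2 h1),
    mul_pos hc' (sub_pos.2 (h3.trans hu))]

theorem listsVerticesCCW_of_next {S : Set (ℤ × ℤ)} {l : List (ℤ × ℤ)} (hl : l ≠ [])
    (hnd : l.Nodup) (hnext : ∀ (i : ℕ) (hi : i < l.length),
      Next S l[i] (l[(i + 1) % l.length]'(Nat.mod_lt _ (Nat.zero_lt_of_lt hi)))) :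
    ListsVerticesCCW (l.map latticePoint) (convexHull ℝ (latticePoint '' S)) := by
  have hpos : 0 < l.length := List.length_pos_iff.2 hl
  have hpred : ∀ q ∈ l, ∃ p ∈ l, Next S p q := by
    intro q hq
    obtain ⟨j, hj, rfl⟩ := List.getElem_of_mem hq
    rcases Nat.eq_zero_or_pos j with rfl | hj0
    · refine ⟨l[l.length - 1], List.getElem_mem _, ?_⟩
      have := hnext (l.length - 1) (by omega)
      simpa only [Nat.sub_add_cancel hpos, Nat.mod_self] using this
    · refine ⟨l[j - 1], List.getElem_mem _, ?_⟩
      have := hnext (j - 1) (by omega)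
      simpa only [Nat.sub_add_cancel hj0, Nat.mod_eq_of_lt hj] using this
  have hsucc : ∀ q ∈ l, ∃ r ∈ l, Next S q r := by
    intro q hq
    obtain ⟨j, hj, rfl⟩ := List.getElem_of_mem hq
    exact ⟨_, List.getElem_mem _, hnext j hj⟩
  have hsub : latticePoint '' S ⊆ convexHull ℝ (latticePoint '' l.toFinset) :=
    subset_convexHull_of_next (by simpa using hl) (by simpa using hpred) (by simpa using hsucc)
  refine ⟨hnd.map latticePoint_injective, ?_, fun i hi z hz => ?_⟩
  · apply Set.Subset.antisymm
    · intro x hx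
      obtain ⟨q, hq, rfl⟩ := List.mem_map.1 hx
      obtain ⟨p, -, hpq⟩ := hpred q hq
      exact hpq.2.2.mem_extremePoints
    · intro x hx
      have hF : latticePoint '' (l.toFinset : Set (ℤ × ℤ)) ⊆ latticePoint '' S := by
        rintro _ ⟨q, hq, rfl⟩
        obtain ⟨p, -, hpq⟩ := hpred q (by simpa using hq)
        exact ⟨q, hpq.2.2.1, rfl⟩
      rw [Set.Subset.antisymm (convexHull_min hsub (convex_convexHull ℝ _))
        (convexHull_mono hF)] at hx
      obtain ⟨q, hq, rfl⟩ := extremePoints_convexHull_subset hx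
      exact List.mem_map.2 ⟨q, by simpa using hq, rfl⟩
  · have hi' : i < l.length := by simpa using hi
    simp only [List.getElem_map, List.length_map]
    exact (hnext i hi').cross_nonneg hz

theorem listsVerticesCCW_singleton (p : ℤ × ℤ) :
    ListsVerticesCCW [latticePoint p] (convexHull ℝ (latticePoint '' {p})) := by
  refine ⟨List.nodup_singleton _, ?_, fun i hi z _ => ?_⟩
  · simp
  · obtain rfl : i = 0 := by simpa using hi
    simp [cross]

/-! ### Size -/

theorem abs_fst_sub_le_diam {C : Set Plane} (hC : IsCompact C) {p q : ℤ × ℤ}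
    (hp : p ∈ integerPoints C) (hq : q ∈ integerPoints C) :
    |((p.1 - q.1 : ℤ) : ℝ)| ≤ Metric.diam C ∧ |((p.2 - q.2 : ℤ) : ℝ)| ≤ Metric.diam C := by
  have h := Metric.dist_le_diam_of_mem hC.isBounded hp hq
  have h0 := PiLp.norm_apply_le (latticePoint p - latticePoint q) 0
  have h1 := PiLp.norm_apply_le (latticePoint p - latticePoint q) 1
  rw [← dist_eq_norm] at h0 h1
  simp only [PiLp.sub_apply, latticePoint_zero, latticePoint_one, Real.norm_eq_abs,
    ← Int.cast_sub] at h0 h1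
  exact ⟨h0.trans h, h1.trans h⟩

theorem finite_integerPoints {C : Set Plane} (hC : IsCompact C) : (integerPoints C).Finite := by
  rcases (integerPoints C).eq_empty_or_nonempty with h | ⟨p, hp⟩
  · simp [h]
  obtain ⟨N, hN⟩ := exists_nat_ge (Metric.diam C)
  refine (Set.finite_Icc (p.1 - N, p.2 - N) (p.1 + N, p.2 + N)).subset fun q hq => ?_
  obtain ⟨h1, h2⟩ := abs_fst_sub_le_diam hC hq hp
  have h1' : |q.1 - p.1| ≤ N := by exact_mod_cast h1.trans hN
  have h2' : |q.2 - p.2| ≤ N := by exact_mod_cast h2.trans hN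
  rw [abs_le] at h1' h2'
  simp only [Set.mem_Icc, Prod.le_def]
  omega

/-- The set of the vertices. -/
def vertexSet (S : Set (ℤ × ℤ)) : Set (ℤ × ℤ) := {p | ∃ d, Supp S p d}

theorem finite_vertexSet {C : Set Plane} (hC : IsCompact C) :
    (vertexSet (integerPoints C)).Finite :=
  (finite_integerPoints hC).subset fun _ ⟨_, h⟩ => h.1

/-- Bounds the rounds of the walk by the number of vertices of the hull; the reverse inequality is
not needed. -/
theorem ncard_vertexSet_le {C : Set Plane} (hC : IsCompact C) :
    (vertexSet (integerPoints C)).ncard ≤ numVertices (discreteHull C) := by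
  rw [← Set.ncard_image_of_injective _ latticePoint_injective, numVertices, discreteHull_eq]
  refine Set.ncard_le_ncard ?_
    (((finite_integerPoints hC).image _).subset extremePoints_convexHull_subset)
  rintro _ ⟨p, ⟨d, h⟩, rfl⟩
  exact h.mem_extremePoints

/-! ### Lattice points on a line -/

theorem latticePoint_add_smul_mem_segment {X D : ℤ × ℤ} (hD : D ≠ 0) {ta tb t : ℝ} :
    latticePoint X + t • latticePoint D ∈
      segment ℝ (latticePoint X + ta • latticePoint D) (latticePoint X + tb • latticePoint D) ↔
    min ta tb ≤ t ∧ t ≤ max ta tb := by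
  have hD' : latticePoint D ≠ 0 := by
    intro h
    apply hD
    apply latticePoint_injective
    rw [h]
    apply plane_ext <;> simp [latticePoint_zero, latticePoint_one]
  have hline : ∀ s : ℝ, AffineMap.lineMap (latticePoint X) (latticePoint X + latticePoint D) s =
      latticePoint X + s • latticePoint D := fun s => by
    simp [AffineMap.lineMap_apply, add_comm]
  rw [← hline, ← hline, ← hline, ← image_segment, segment_eq_uIcc]
  constructor
  · rintro ⟨s, hs, hst⟩
    have : s = t := smul_left_injective ℝ hD' (add_left_cancel (by
      rwa [hline, hline] at hst))
    rwa [← this]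
  · intro h
    exact ⟨t, h, rfl⟩

/-! ### Lattice points of the input set on a lattice line -/

section Budget

variable {Q : LineOracle} {f g : Frag} {n N : ℕ} {r : ℕ → ℝ} {o : List Plane}
  {Post : (ℕ → ℝ) → List Plane → Prop}

theorem Wp.seq_of_le (hn : n ≤ N) (h : Wp Q f n r o fun r' o' => Wp Q g (N - n) r' o' Post) :
    Wp Q (f.seq g) N r o Post :=
  (Wp.seq h).mono (by omega) fun _ _ h => h

theorem Wp.block_seq {l : List Instr} (hl : l.length ≤ N) (hs : SafeBlock l r)
    (h : Wp Q g (N - l.length) (evalBlock l r) o Post) :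
    Wp Q ((Frag.block l).seq g) N r o Post :=
  Wp.seq_of_le hl (Wp.block le_rfl hs h)

/-- The instruction writes no register below `B`. -/
def Instr.WritesFrom (B : ℕ) : Instr → Bool
  | .const d _ => B ≤ d
  | .copy d _ => B ≤ d
  | .add d _ _ => B ≤ d
  | .sub d _ _ => B ≤ d
  | .mul d _ _ => B ≤ d
  | .div d _ _ => B ≤ d
  | .floor d _ => B ≤ d
  | _ => false

theorem evalBlock_of_writesFrom {B : ℕ} {l : List Instr} (hl : l.all (Instr.WritesFrom B))
    (r : ℕ → ℝ) {i : ℕ} (hi : i < B) : evalBlock l r i = r i := by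
  induction l generalizing r with
  | nil => rfl
  | cons j l ih =>
    simp only [List.all_cons, Bool.and_eq_true] at hl
    rw [evalBlock, ih hl.2]
    obtain ⟨h, -⟩ := hl
    cases j <;> simp only [Instr.WritesFrom, decide_eq_true_eq, Bool.false_eq_true] at h <;>
      exact Function.update_of_ne (by omega) _ _

end Budget

/-- Compute in registers `18` and `19` integers `lo`, `hi` such that the points `X + tD`, `t ∈ ℤ`,
of the input set are those with `lo ≤ t ≤ hi`, where `X` and `D ≠ 0` are the vectors in the
registers `20`, `21` and `22`, `23`. -/
def lineRange : Frag :=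
  (Frag.block [.query 24 20]).seq <|
  (Frag.block [.const 18 1, .const 19 0, .const 29 1]).seq <|
  Frag.unlessLT 24 29 <|
    (Frag.block [.mul 30 22 22, .mul 31 23 23, .add 30 30 31,
      .sub 25 25 20, .sub 26 26 21, .mul 25 25 22, .mul 26 26 23, .add 25 25 26, .div 25 25 30,
      .sub 27 27 20, .sub 28 28 21, .mul 27 27 22, .mul 28 28 23, .add 27 27 28,
      .div 27 27 30]).seq <|
    (Frag.unlessLT 25 27 (Frag.block [.copy 26 25, .copy 25 27, .copy 27 26])).seq <|
    Frag.block [.const 26 0, .sub 18 26 25, .floor 18 18, .sub 18 26 18, .floor 19 27]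

/-- The vector with the coordinates `R[i]`, `R[i+1]` is `a`. -/
def Holds (r : ℕ → ℝ) (i : ℕ) (a : ℤ × ℤ) : Prop := r i = a.1 ∧ r (i + 1) = a.2

theorem LineOracle.Computes.param {C : Set Plane} {Q : LineOracle} (hQ : Q.Computes C)
    {X D : ℤ × ℤ} (hD : D ≠ 0) {a b : Plane}
    (h : Q (latticePoint X) (latticePoint D) = some (a, b)) :
    ∃ ta tb : ℝ, a = latticePoint X + ta • latticePoint D ∧
      b = latticePoint X + tb • latticePoint D ∧
      ∀ t : ℤ, X + t • D ∈ integerPoints C ↔ min ta tb ≤ t ∧ t ≤ max ta tb := by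
  have hD' : latticePoint D ≠ 0 := by
    intro h
    apply hD
    apply latticePoint_injective
    rw [h]
    apply plane_ext <;> simp [latticePoint_zero, latticePoint_one]
  have hq := hQ (latticePoint X) (latticePoint D) hD'
  rw [h] at hq
  simp only at hq
  have ha : a ∈ C ∩ lineThrough (latticePoint X) (latticePoint D) :=
    hq ▸ left_mem_segment ℝ a b
  have hb : b ∈ C ∩ lineThrough (latticePoint X) (latticePoint D) :=
    hq ▸ right_mem_segment ℝ a b
  obtain ⟨-, ta, rfl⟩ := ha
  obtain ⟨-, tb, rfl⟩ := hb
  refine ⟨ta, tb, rfl, rfl, fun t => ?_⟩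
  rw [← latticePoint_add_smul_mem_segment hD, ← hq, ← latticePoint_smul, ← latticePoint_add]
  exact ⟨fun h => ⟨h, t, by rw [← latticePoint_smul, ← latticePoint_add]⟩, fun h => h.1⟩

theorem LineOracle.Computes.none {C : Set Plane} {Q : LineOracle} (hQ : Q.Computes C)
    {X D : ℤ × ℤ} (hD : D ≠ 0) (h : Q (latticePoint X) (latticePoint D) = none) (t : ℤ) :
    X + t • D ∉ integerPoints C := by
  have hD' : latticePoint D ≠ 0 := by
    intro h
    apply hD
    apply latticePoint_injective
    rw [h]
    apply plane_ext <;> simp [latticePoint_zero, latticePoint_one]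
  have hq := hQ (latticePoint X) (latticePoint D) hD'
  rw [h] at hq
  simp only at hq
  intro hm
  have : latticePoint (X + t • D) ∈ C ∩ lineThrough (latticePoint X) (latticePoint D) :=
    ⟨hm, t, by rw [← latticePoint_smul, ← latticePoint_add]⟩
  rw [hq] at this
  exact this

theorem lineRange_spec {C : Set Plane} {Q : LineOracle} (hQ : Q.Computes C) {X D : ℤ × ℤ}
    (hD : D ≠ 0) {r : ℕ → ℝ} {o : List Plane} (hrX : Holds r 20 X) (hrD : Holds r 22 D) :
    Wp Q lineRange 29 r o fun r' o' => o' = o ∧ (∀ i < 18, r' i = r i) ∧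
      ∃ lo hi : ℤ, r' 18 = lo ∧ r' 19 = hi ∧
        ∀ t : ℤ, X + t • D ∈ integerPoints C ↔ lo ≤ t ∧ t ≤ hi := by
  obtain ⟨X0, X1⟩ := hrX
  obtain ⟨D0, D1⟩ := hrD
  have hdd : (0 : ℝ) < D.1 * D.1 + D.2 * D.2 := by
    have := dot_self_pos hD
    simp only [dot] at this
    exact_mod_cast this
  have eX : !₂[r 20, r (20 + 1)] = latticePoint X := by rw [X0, X1]; rfl
  have eD : !₂[r (20 + 2), r (20 + 3)] = latticePoint D := by
    rw [show 20 + 2 = 22 from rfl, show 20 + 3 = 22 + 1 from rfl, D0, D1]; rfl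
  norm_num at X1 D1
  refine Wp.seq_of_le (n := 1) (by norm_num) (Wp.query ?_ ?_ ?_)
  · simp only [Nat.reduceAdd, D0, D1, Int.cast_eq_zero]
    exact fun h => hD (Prod.ext h.1 h.2)
  · rw [eX, eD]
    intro hq
    refine Wp.block_seq (by simp) (by simp [SafeBlock, Instr.Safe]) ?_
    refine Wp.mono (n := 1 + 1) (Wp.unlessLT ?_ ?_) (by simp) fun _ _ h => h
    -- An empty intersection is encoded by the empty interval with `lo` = 1 and `hi` = 0, the preset
    -- values.
    · refine fun _ => ⟨rfl, fun i hi => ?_, 1, 0, ?_, ?_, fun t => ?_⟩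
      · rw [evalBlock_of_writesFrom (B := 18) rfl _ hi, Function.update_of_ne (by omega)]
      · simp [evalBlock, Instr.eval]
      · simp [evalBlock, Instr.eval]
      · have := hQ.none hD hq t
        simp only [this, false_iff]
        omega
    · exact fun h => absurd (by simp [evalBlock, Instr.eval]) h
  · intro a b hq
    rw [eX, eD] at hq
    obtain ⟨ta, tb, rfl, rfl, hab⟩ := hQ.param hD hq
    refine Wp.block_seq (by simp) (by simp [SafeBlock, Instr.Safe]) ?_
    refine Wp.mono (n := 24 + 1) (Wp.unlessLT ?_ fun _ => ?_) (by simp) fun _ _ h => h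
    · exact fun h => absurd h (by simp [evalBlock, Instr.eval])
    -- From here on only the parameters of the endpoints along D matter; the order in which the
    -- query reported them is repaired by a swap.
    have key : ∀ r1 : ℕ → ℝ, r1 25 = ta → r1 27 = tb → (∀ i < 18, r1 i = r i) →
        Wp Q ((Frag.unlessLT 25 27 (Frag.block [.copy 26 25, .copy 25 27, .copy 27 26])).seq <|
          Frag.block [.const 26 0, .sub 18 26 25, .floor 18 18, .sub 18 26 18, .floor 19 27]) 9
          r1 o fun r' o' => o' = o ∧ (∀ i < 18, r' i = r i) ∧
            ∃ lo hi : ℤ, r' 18 = lo ∧ r' 19 = hi ∧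
              ∀ t : ℤ, X + t • D ∈ integerPoints C ↔ lo ≤ t ∧ t ≤ hi := by
      intro r1 h25 h27 hfr
      have key2 : ∀ r2 : ℕ → ℝ, r2 25 = min ta tb → r2 27 = max ta tb →
          (∀ i < 18, r2 i = r i) →
          Wp Q (Frag.block [.const 26 0, .sub 18 26 25, .floor 18 18, .sub 18 26 18,
            .floor 19 27]) 5 r2 o fun r' o' => o' = o ∧ (∀ i < 18, r' i = r i) ∧
            ∃ lo hi : ℤ, r' 18 = lo ∧ r' 19 = hi ∧
              ∀ t : ℤ, X + t • D ∈ integerPoints C ↔ lo ≤ t ∧ t ≤ hi := by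
        intro r2 h25 h27 hfr
        -- The machine has no ceiling, which is computed as -⌊-x⌋.
        refine Wp.block (by simp) (by simp [SafeBlock, Instr.Safe]) ⟨rfl, fun i hi => ?_,
          ⌈min ta tb⌉, ⌊max ta tb⌋, ?_, ?_, fun t => ?_⟩
        · rw [evalBlock_of_writesFrom (B := 18) rfl _ hi, hfr i hi]
        · simp [evalBlock, Instr.eval, h25, Int.floor_neg]
        · simp [evalBlock, Instr.eval, h27]
        · rw [hab, Int.ceil_le, Int.le_floor]
      refine Wp.seq_of_le (n := 3 + 1) (by norm_num) (Wp.unlessLT (fun h => ?_) fun h =>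
        Wp.block (by simp) (by simp [SafeBlock, Instr.Safe]) ?_)
      · rw [h25, h27] at h
        exact key2 _ (by rw [h25, min_eq_left h.le]) (by rw [h27, max_eq_right h.le]) hfr
      · rw [h25, h27, not_lt] at h
        refine key2 _ ?_ ?_ fun i hi => ?_
        · simp [evalBlock, Instr.eval, h27, min_eq_right h]
        · simp [evalBlock, Instr.eval, h25, max_eq_left h]
        · rw [evalBlock_of_writesFrom (B := 18) rfl _ hi, hfr i hi]
    refine Wp.block_seq (by simp) ?_ ((key _ ?_ ?_ ?_).mono (by simp) fun _ _ h => h)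
    · simp [SafeBlock, Instr.Safe, evalBlock, Instr.eval, D0, D1, hdd.ne']
    · simp [evalBlock, Instr.eval, X0, X1, D0, D1, PiLp.add_apply,
        PiLp.smul_apply, latticePoint_zero, latticePoint_one]
      -- The parameter of an endpoint is recovered as ((endpoint - X)·D)/(D·D), which avoids
      -- distinguishing vertical directions.
      rw [div_eq_iff hdd.ne']
      ring
    · simp [evalBlock, Instr.eval, X0, X1, D0, D1, PiLp.add_apply,
        PiLp.smul_apply, latticePoint_zero, latticePoint_one]
      rw [div_eq_iff hdd.ne']
      ring
    · intro i hi
      rw [evalBlock_of_writesFrom (B := 18) rfl _ hi, evalBlock_of_writesFrom (B := 18) rfl _ hi]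
      iterate 5 rw [Function.update_of_ne (by omega)]

theorem lineRange_seq {C : Set Plane} {Q : LineOracle} (hQ : Q.Computes C) (X D : ℤ × ℤ)
    (hD : D ≠ 0) {r : ℕ → ℝ} {o : List Plane} {l : List Instr} {g : Frag} {N : ℕ}
    {Post : (ℕ → ℝ) → List Plane → Prop} (hw : l.all (Instr.WritesFrom 18))
    (hs : SafeBlock l r) (hX : Holds (evalBlock l r) 20 X) (hD' : Holds (evalBlock l r) 22 D)
    (hN : l.length + 29 ≤ N)
    (h : ∀ (r' : ℕ → ℝ) (lo hi : ℤ), (∀ i < 18, r' i = r i) → r' 18 = lo → r' 19 = hi →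
      (∀ t : ℤ, X + t • D ∈ integerPoints C ↔ lo ≤ t ∧ t ≤ hi) →
      Wp Q g (N - (l.length + 29)) r' o Post) :
    Wp Q ((Frag.block l).seq (lineRange.seq g)) N r o Post := by
  refine Wp.block_seq (by omega) hs (Wp.seq_of_le (n := 29) (by omega)
    ((lineRange_spec hQ hD hX hD').mono le_rfl ?_))
  rintro r' _ ⟨rfl, hfr, lo, hi, h18, h19, hlh⟩
  rw [Nat.sub_sub]
  exact h r' lo hi (fun i hi => by rw [hfr i hi, evalBlock_of_writesFrom hw _ hi]) h18 h19 hlh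

/-! ### The next vertex -/

/-- One step of the search: the vertex `p` is in the registers `0`, `1`, and the vectors `u`, `w`
are in the registers `2` to `5`. -/
def searchStep : Frag :=
  (Frag.block [.add 20 0 4, .add 21 1 5, .copy 22 2, .copy 23 3]).seq <| lineRange.seq <|
  (Frag.block [.mul 20 19 2, .add 4 4 20, .mul 20 19 3, .add 5 5 20]).seq <|
  (Frag.block [.add 20 0 2, .add 21 1 3, .copy 22 4, .copy 23 5]).seq <| lineRange.seq <|
  (Frag.block [.const 14 1, .const 15 0, .const 16 1]).seq <|
  Frag.unlessLT 19 18 <| Frag.unlessLT 18 16 <|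
    Frag.block [.sub 18 18 16, .mul 20 18 4, .add 2 2 20, .mul 20 18 5, .add 3 3 20, .const 15 2]

theorem searchStep_spec {C : Set Plane} {Q : LineOracle} (hQ : Q.Computes C)
    (hS : LatConvex (integerPoints C)) {p d u₀ u w : ℤ × ℤ} (hd : Supp (integerPoints C) p d)
    (h : SearchInv (integerPoints C) p u₀ u w) {r : ℕ → ℝ} {o : List Plane}
    (h0 : Holds r 0 p) (h2 : Holds r 2 u) (h4 : Holds r 4 w) :
    Wp Q searchStep 81 r o fun r' o' => o' = o ∧ (∀ i ∈ [0, 1, 6, 7, 10, 11], r' i = r i) ∧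
      ∃ (a : ℤ) (w' : ℤ × ℤ), w' = w + a • u ∧ 0 ≤ a ∧ (p + (u + w) ∈ integerPoints C → 1 ≤ a) ∧ Holds r' 4 w' ∧
        ((r' 14 < r' 15 ∧ ∃ c : ℤ, 1 ≤ c ∧ Holds r' 2 (u + c • w') ∧
            SearchInv (integerPoints C) p u₀ (u + c • w') w' ∧
            p + (u + c • w' + w') ∈ integerPoints C) ∨
          (¬ r' 14 < r' 15 ∧ SearchInv (integerPoints C) p u₀ u w' ∧
            ∀ z, p + z ∈ integerPoints C → 0 ≤ det w' z)) := by
  obtain ⟨h0, h1⟩ := h0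
  obtain ⟨h2, h3⟩ := h2
  obtain ⟨h4, h5⟩ := h4
  norm_num at h1 h3 h5
  have hu : u ≠ 0 := by
    rintro rfl
    simpa [det] using h.det_eq
  refine lineRange_seq hQ (p + w) u hu rfl (by simp [SafeBlock, Instr.Safe])
    (by simp [Holds, evalBlock, Instr.eval, h0, h1, h4, h5])
    (by simp [Holds, evalBlock, Instr.eval, h2, h3]) (by simp) ?_
  intro r1 lo a hr1 _ h19 hlh
  have hlo : lo ≤ 0 ∧ 0 ≤ a := (hlh 0).1 (by simpa using h.mem)
  have ha : p + (w + a • u) ∈ integerPoints C := by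
    rw [← add_assoc]; exact (hlh a).2 ⟨by omega, le_rfl⟩
  have ha' : p + (u + (w + a • u)) ∉ integerPoints C := fun hm => by
    have := (hlh (a + 1)).1 (by convert hm using 1; module)
    omega
  have ha1 : p + (u + w) ∈ integerPoints C → 1 ≤ a := fun hm =>
    ((hlh 1).1 (by convert hm using 1; module)).2
  have hw := h.advance_right hd hlo.2 ha
  refine Wp.block_seq (by simp) (by simp [SafeBlock, Instr.Safe]) ?_
  refine lineRange_seq hQ (p + u) (w + a • u) hw.right_ne_zero rfl
    (by simp [SafeBlock, Instr.Safe])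
    (by simp [Holds, evalBlock, Instr.eval, hr1, h0, h1, h2, h3])
    (by simp [Holds, evalBlock, Instr.eval, hr1, h2, h3, h4, h5, h19]) (by simp) ?_
  intro r2 lo' hi' hr2 h18' h19' hlh'
  have k0 : r2 0 = r 0 := by simp [hr2, hr1, evalBlock, Instr.eval]
  have k1 : r2 1 = r 1 := by simp [hr2, hr1, evalBlock, Instr.eval]
  have k6 : r2 6 = r 6 := by simp [hr2, hr1, evalBlock, Instr.eval]
  have k7 : r2 7 = r 7 := by simp [hr2, hr1, evalBlock, Instr.eval]
  have k10 : r2 10 = r 10 := by simp [hr2, hr1, evalBlock, Instr.eval]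
  have k11 : r2 11 = r 11 := by simp [hr2, hr1, evalBlock, Instr.eval]
  have k2 : r2 2 = u.1 := by simp [hr2, hr1, evalBlock, Instr.eval, h2]
  have k3 : r2 3 = u.2 := by simp [hr2, hr1, evalBlock, Instr.eval, h3]
  have k4 : r2 4 = (w + a • u).1 := by simp [hr2, hr1, evalBlock, Instr.eval, h2, h4, h19]
  have k5 : r2 5 = (w + a • u).2 := by simp [hr2, hr1, evalBlock, Instr.eval, h3, h5, h19]
  simp only [add_assoc] at hlh'
  generalize hw' : w + a • u = w' at *
  -- As p + u is not in S, the interval of parameters avoids 0 and lies entirely on one side of it;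
  -- only the positive side keeps the search going.
  have h0' : ¬ (lo' ≤ 0 ∧ 0 ≤ hi') := fun hc => h.not_mem (by simpa using (hlh' 0).2 hc)
  have hdone : (hi' < lo' ∨ lo' < 1) → ∀ z, p + z ∈ integerPoints C → 0 ≤ det w' z :=
    fun hor z hz => hw.left_of_forall_not_mem hS hd.1 (fun s hs hm => by
      have := (hlh' s).1 hm
      omega) hz
  refine Wp.block_seq (by simp) (by simp [SafeBlock, Instr.Safe]) ?_
  refine Wp.mono (n := 8) (Wp.unlessLT (fun hlt => ?_) fun hlt => Wp.unlessLT (fun hlt' => ?_)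
    fun hlt' => Wp.block (by simp) (by simp [SafeBlock, Instr.Safe]) ?_) (by simp) fun _ _ h => h
  · refine ⟨rfl, ?_, a, w', hw'.symm, hlo.2, ha1, ?_, Or.inr ⟨?_, hw, hdone (Or.inl ?_)⟩⟩
    · simp [evalBlock, Instr.eval, k0, k1, k6, k7, k10, k11]
    · simp [Holds, evalBlock, Instr.eval, k4, k5]
    · simp [evalBlock, Instr.eval]
    · simpa [evalBlock, Instr.eval, h18', h19'] using hlt
  · refine ⟨rfl, ?_, a, w', hw'.symm, hlo.2, ha1, ?_, Or.inr ⟨?_, hw, hdone (Or.inr ?_)⟩⟩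
    · simp [evalBlock, Instr.eval, k0, k1, k6, k7, k10, k11]
    · simp [Holds, evalBlock, Instr.eval, k4, k5]
    · simp [evalBlock, Instr.eval]
    · have : (lo' : ℝ) < 1 := by simpa [evalBlock, Instr.eval, h18', h19'] using hlt'
      exact_mod_cast this
  · have hle : lo' ≤ hi' := by
      have : ¬ ((hi' : ℝ) < lo') := by simpa [evalBlock, Instr.eval, h18', h19'] using hlt
      exact_mod_cast not_lt.1 this
    have hpos : 1 ≤ lo' := by
      have : ¬ ((lo' : ℝ) < 1) := by simpa [evalBlock, Instr.eval, h18', h19'] using hlt'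
      exact_mod_cast not_lt.1 this
    have hm := (hlh' lo').2 ⟨le_rfl, hle⟩
    -- The maximality of `a` excludes p + u + w', so the first hit has `lo'` ≥ 2 and u moves by at
    -- least one copy of w'.
    have hne : lo' ≠ 1 := fun h1 => ha' (by rw [h1, one_smul] at hm; exact hm)
    refine ⟨rfl, ?_, a, w', hw'.symm, hlo.2, ha1, ?_, Or.inl ⟨?_, lo' - 1, by omega, ?_, ?_, ?_⟩⟩
    · simp [evalBlock, Instr.eval, k0, k1, k6, k7, k10, k11]
    · simp [Holds, evalBlock, Instr.eval, k4, k5]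
    · simp [evalBlock, Instr.eval]
    · simp [Holds, evalBlock, Instr.eval, k2, k3, k4, k5, h18']
    · refine hw.advance_left hS hd.1 (by omega) (by rw [sub_add_cancel]; exact hm) fun hm' => ?_
      have := (hlh' (lo' - 1)).1 hm'
      omega
    · convert hm using 2
      module

/-- The search for the direction of the edge that starts at `p`. -/
def search : Frag := searchStep.doWhile 14 15

/-- The potential is the height `det u₀ (u + w)`: it at least doubles in every round that continues,
and stays below N because p + u + w is in S. -/
theorem search_spec_of_add_mem {C : Set Plane} {Q : LineOracle} (hQ : Q.Computes C)
    (hS : LatConvex (integerPoints C)) {p d u₀ : ℤ × ℤ} (hd : Supp (integerPoints C) p d)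
    {N : ℤ} (hN : ∀ z, p + z ∈ integerPoints C → det u₀ z < N) {o : List Plane} {R : ℕ → ℝ}
    (m : ℕ) : ∀ {u w : ℤ × ℤ} {r : ℕ → ℝ}, SearchInv (integerPoints C) p u₀ u w →
      p + (u + w) ∈ integerPoints C → N ≤ 2 ^ m * det u₀ (u + w) →
      Holds r 0 p → Holds r 2 u → Holds r 4 w → (∀ i ∈ [0, 1, 6, 7, 10, 11], r i = R i) →
    Wp Q search (82 * m) r o fun r' o' => o' = o ∧
      (∀ i ∈ [0, 1, 6, 7, 10, 11], r' i = R i) ∧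
      ∃ u' w' : ℤ × ℤ, Holds r' 4 w' ∧ SearchInv (integerPoints C) p u₀ u' w' ∧
        ∀ z, p + z ∈ integerPoints C → 0 ≤ det w' z := by
  induction m with
  | zero =>
    intro u w r h hm hle
    have := hN _ hm
    omega
  | succ m ih =>
    intro u w r h hm hle h0 h2 h4 hR
    refine Wp.mono (n := 81 + 1 + 82 * m) (Wp.doWhile ((searchStep_spec hQ hS hd h h0 h2 h4).mono
      le_rfl ?_)) (by omega) fun _ _ h => h
    rintro r' _ ⟨rfl, hfr, a, _, rfl, ha, ha1, h4', hc⟩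
    have hR' : ∀ i ∈ [0, 1, 6, 7, 10, 11], r' i = R i := fun i hi => by rw [hfr i hi, hR i hi]
    rcases hc with ⟨hlt, c, hc, h2', hinv, hm'⟩ | ⟨hlt, hinv, hl⟩
    · refine ⟨fun _ => ih hinv hm' (hle.trans ?_) ?_ h2' h4' hR', fun h => absurd hlt h⟩
      · rw [pow_succ, mul_assoc]
        refine mul_le_mul_of_nonneg_left ?_ (by positivity)
        -- The new sum is u + (c+1)(w + au). As a, c ≥ 1 and the heights of u, w are nonnegative, it
        -- is at least as high as u + 2(u + w).
        simp only [det_add, det_smul]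
        have h1 := h.nonneg
        have h2 := h.pos
        have h3 := ha1 hm
        nlinarith [mul_nonneg (sub_nonneg.2 hc) (add_nonneg h2.le (mul_nonneg ha h1)),
          mul_nonneg (sub_nonneg.2 h3) h1]
      · exact ⟨by rw [hfr 0 (by simp)]; exact h0.1, by rw [hfr (0 + 1) (by simp)]; exact h0.2⟩
    · exact ⟨fun h => absurd h hlt, fun _ => ⟨rfl, hR', _, _, h4', hinv, hl⟩⟩

/-- The first round is split off because p + u + w need not lie in S at the start. After it the
height of the sum is at least 1, and m doublings suffice. -/
theorem search_spec {C : Set Plane} {Q : LineOracle} (hQ : Q.Computes C)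
    (hS : LatConvex (integerPoints C)) {p d u₀ u w : ℤ × ℤ} (hd : Supp (integerPoints C) p d)
    {m : ℕ} (hN : ∀ z, p + z ∈ integerPoints C → det u₀ z < 2 ^ m) {o : List Plane} {r : ℕ → ℝ}
    (h : SearchInv (integerPoints C) p u₀ u w) (h0 : Holds r 0 p) (h2 : Holds r 2 u)
    (h4 : Holds r 4 w) :
    Wp Q search (82 * (m + 1)) r o fun r' o' => o' = o ∧
      (∀ i ∈ [0, 1, 6, 7, 10, 11], r' i = r i) ∧
      ∃ u' w' : ℤ × ℤ, Holds r' 4 w' ∧ SearchInv (integerPoints C) p u₀ u' w' ∧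
        ∀ z, p + z ∈ integerPoints C → 0 ≤ det w' z := by
  refine Wp.mono (n := 81 + 1 + 82 * m) (Wp.doWhile ((searchStep_spec hQ hS hd h h0 h2 h4).mono
    le_rfl ?_)) (by omega) fun _ _ h => h
  rintro r' _ ⟨rfl, hfr, a, _, rfl, ha, -, h4', hc⟩
  rcases hc with ⟨hlt, c, hc, h2', hinv, hm'⟩ | ⟨hlt, hinv, hl⟩
  · refine ⟨fun _ => search_spec_of_add_mem hQ hS hd hN m hinv hm' ?_ ?_ h2' h4' hfr,
      fun h => absurd hlt h⟩
    · refine le_mul_of_one_le_right (by positivity) ?_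
      rw [det_add]
      linarith [hinv.nonneg, Int.add_one_le_iff.2 hinv.pos]
    · exact ⟨by rw [hfr 0 (by simp)]; exact h0.1, by rw [hfr (0 + 1) (by simp)]; exact h0.2⟩
  · exact ⟨fun h => absurd h hlt, fun _ => ⟨rfl, hfr, _, _, h4', hinv, hl⟩⟩

/-- Rotate the unit vector in the registers `10`, `11`, and test whether it leads from `p` to a
neighbour. The vector before the rotation is left in the registers `2`, `3`. -/
def turnStep : Frag :=
  (Frag.block [.copy 2 10, .copy 3 11, .const 10 0, .sub 10 10 3, .copy 11 2]).seq <|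
  (Frag.block [.copy 20 0, .copy 21 1, .copy 22 10, .copy 23 11]).seq <| lineRange.seq <|
  Frag.block [.const 12 1, .add 9 9 12, .const 13 4, .mul 12 19 13, .add 12 12 9]

/-- Rotate the unit vector in the registers `10`, `11` until it leads from `p` to a neighbour, or
four times. The vector before the last turn is left in the registers `2`, `3`. -/
def turnAxis : Frag := turnStep.doWhile 12 13

theorem turnAxis_spec {C : Set Plane} {Q : LineOracle} (hQ : Q.Computes C)
    {p : ℤ × ℤ} (hp : p ∈ integerPoints C) {o : List Plane} {R : ℕ → ℝ}
    {a : ℤ × ℤ} (ha : IsAxis a) (m : ℕ) : ∀ {j : ℕ} {r : ℕ → ℝ}, j + m + 1 = 4 →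
      r 9 = j → (∀ i ≤ j, p + rot^[i] a ∉ integerPoints C) → Holds r 0 p →
      Holds r 10 (rot^[j] a) → (∀ i ∈ [0, 1, 6, 7], r i = R i) →
    Wp Q turnAxis (50 * (m + 1)) r o fun r' o' => o' = o ∧ (∀ i ∈ [0, 1, 6, 7], r' i = R i) ∧
      ∃ (u : ℤ × ℤ) (hi : ℤ), IsAxis u ∧ r' 19 = hi ∧ Holds r' 2 u ∧ Holds r' 10 (rot u) ∧
        p + u ∉ integerPoints C ∧ (1 ≤ hi → p + rot u ∈ integerPoints C) ∧
        (hi < 1 → ∀ b, IsAxis b → p + b ∉ integerPoints C) := by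
  have hax : ∀ j, IsAxis (rot^[j] a) := fun j => by
    induction j with
    | zero => exact ha
    | succ j ih => rw [Function.iterate_succ_apply']; exact ih.rot
  have main : ∀ {j : ℕ} {r : ℕ → ℝ}, r 9 = j → (∀ i ≤ j, p + rot^[i] a ∉ integerPoints C) →
      Holds r 0 p → Holds r 10 (rot^[j] a) → (∀ i ∈ [0, 1, 6, 7], r i = R i) →
      Wp Q turnStep 49 r o
      fun r' o' => o' = o ∧ (∀ i ∈ [0, 1, 6, 7], r' i = R i) ∧ r' 9 = (j + 1 : ℕ) ∧
        Holds r' 0 p ∧ Holds r' 2 (rot^[j] a) ∧ Holds r' 10 (rot^[j + 1] a) ∧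
        ∃ hi : ℤ, 0 ≤ hi ∧ r' 19 = hi ∧ (r' 12 < r' 13 ↔ 4 * hi + j + 1 < 4) ∧
          (1 ≤ hi ↔ p + rot^[j + 1] a ∈ integerPoints C) := by
    intro j r h9 hj h0 h10 hR
    obtain ⟨h0, h1⟩ := h0
    obtain ⟨h10, h11⟩ := h10
    norm_num at h1 h11
    rw [Function.iterate_succ_apply']
    have hu := hax j
    generalize rot^[j] a = u at *
    refine Wp.block_seq (by simp) (by simp [SafeBlock, Instr.Safe]) ?_
    refine lineRange_seq hQ p (rot u) hu.rot.ne_zero rfl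
      (by simp [SafeBlock, Instr.Safe]) (by simp [Holds, evalBlock, Instr.eval, h0, h1])
      (by simp [Holds, evalBlock, Instr.eval, h10, h11, rot]) (by simp) ?_
    intro r1 lo hi hr1 _ h19 hlh
    have h00 := (hlh 0).1 (by simpa using hp)
    have h01 := hlh 1
    rw [one_smul] at h01
    refine Wp.block (by simp) (by simp [SafeBlock, Instr.Safe])
      ⟨rfl, ?_, ?_, ?_, ?_, ?_, hi, h00.2, ?_, ?_, ?_⟩
    · simpa [evalBlock, Instr.eval, hr1] using hR
    · simp [evalBlock, Instr.eval, hr1, h9]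
    · simp [Holds, evalBlock, Instr.eval, hr1, h0, h1]
    · simp [Holds, evalBlock, Instr.eval, hr1, h10, h11]
    · simp [Holds, evalBlock, Instr.eval, hr1, h10, h11, rot]
    -- The number `hi` is nonnegative because p itself is on the queried line. Hence the single test
    -- 4·hi + (number of turns) < 4 means that no neighbour was found and fewer than four turns were
    -- made.
    · simp [evalBlock, Instr.eval, h19]
    · simp [evalBlock, Instr.eval, hr1, h19, h9]
      rw [← @Int.cast_lt ℝ]
      push_cast
      ring_nf
    · rw [h01]
      omega
  induction m with
  | zero =>
    intro j r hj h9 hjn h0 h10 hR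
    obtain rfl : j = 3 := by omega
    refine Wp.mono (n := 49 + 1 + 0) (Wp.doWhile ((main h9 hjn h0 h10 hR).mono le_rfl ?_))
      le_rfl fun _ _ h => h
    rintro r' _ ⟨rfl, hR', h9', h0', h2', h10', hi, hi0, h19, hlt, h1⟩
    refine ⟨fun h => ?_, fun _ => ⟨rfl, hR', rot^[3] a, hi, hax 3, h19, h2', ?_, hjn 3 le_rfl,
      ?_, fun hi1 b hb => ?_⟩⟩
    · rw [hlt] at h
      push_cast at h
      omega
    · rwa [← Function.iterate_succ_apply' rot]
    · rw [h1, ← Function.iterate_succ_apply' rot]; exact id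
    · have : ∃ i ≤ 3, rot^[i] a = b := by
        rcases ha with rfl | rfl | rfl | rfl <;> rcases hb with rfl | rfl | rfl | rfl <;> first
          | exact ⟨0, by omega, rfl⟩
          | exact ⟨1, by omega, rfl⟩
          | exact ⟨2, by omega, rfl⟩
          | exact ⟨3, by omega, rfl⟩
      obtain ⟨i, hi, rfl⟩ := this
      exact hjn i hi
  | succ m ih =>
    intro j r hj h9 hjn h0 h10 hR
    refine Wp.mono (n := 49 + 1 + 50 * (m + 1))
      (Wp.doWhile ((main h9 hjn h0 h10 hR).mono le_rfl ?_)) (by omega) fun _ _ h => h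
    rintro r' _ ⟨rfl, hR', h9', h0', h2', h10', hi, hi0, h19, hlt, h1⟩
    refine ⟨fun h => ih (j := j + 1) (by omega) h9' (fun i hi' => ?_) h0' h10' hR', fun h =>
      ⟨rfl, hR', rot^[j] a, hi, hax j, h19, h2', ?_, hjn j le_rfl, ?_, fun hi1 => ?_⟩⟩
    · rcases Nat.le_succ_iff.1 hi' with hi' | rfl
      · exact hjn i hi'
      · rw [hlt] at h
        rw [Nat.succ_eq_add_one, ← h1]
        omega
    · rwa [← Function.iterate_succ_apply' rot]
    · rw [h1, ← Function.iterate_succ_apply' rot]; exact id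
    · rw [hlt] at h
      omega

/-- Replace the vertex `p` in the registers `0`, `1` by its successor. The registers `10`, `11`
hold a unit vector that does not lead from the vertex to a neighbour. -/
def advance : Frag :=
  (Frag.block [.const 9 0]).seq <| turnAxis.seq <|
  (Frag.block [.const 12 1]).seq <| Frag.unlessLT 19 12 <|
    (Frag.block [.copy 4 10, .copy 5 11]).seq <| search.seq <|
    (Frag.block [.copy 20 0, .copy 21 1, .copy 22 4, .copy 23 5]).seq <| lineRange.seq <|
    Frag.block [.mul 20 19 4, .add 0 0 20, .mul 20 19 5, .add 1 1 20,
      .copy 12 10, .copy 10 11, .const 11 0, .sub 11 11 12]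

theorem advance_spec {C : Set Plane} {Q : LineOracle} (hQ : Q.Computes C)
    (hS : LatConvex (integerPoints C)) (hc : LatticeConnected (integerPoints C)) {m : ℕ}
    (hm : ∀ y ∈ integerPoints C, ∀ z ∈ integerPoints C,
      |y.1 - z.1| < 2 ^ m ∧ |y.2 - z.2| < 2 ^ m)
    {p d a : ℤ × ℤ} (hd : Supp (integerPoints C) p d) (ha : IsAxis a)
    (hpa : p + a ∉ integerPoints C) {r : ℕ → ℝ} {o : List Plane} (h0 : Holds r 0 p)
    (h10 : Holds r 10 a) :
    Wp Q advance (82 * m + 330) r o fun r' o' => o' = o ∧ r' 6 = r 6 ∧ r' 7 = r 7 ∧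
      ∃ q a' : ℤ × ℤ, Holds r' 0 q ∧ Holds r' 10 a' ∧ IsAxis a' ∧
        ((∀ z ∈ integerPoints C, z = p) ∧ q = p ∨
          Next (integerPoints C) p q ∧ q + a' ∉ integerPoints C) := by
  obtain ⟨h0, h1⟩ := h0
  obtain ⟨h10, h11⟩ := h10
  norm_num at h1 h11
  refine Wp.block_seq (by simp) (by simp [SafeBlock, Instr.Safe]) ?_
  refine Wp.seq_of_le (n := 200) (by simp) ((turnAxis_spec hQ hd.1 ha 3
    (R := r) (j := 0) rfl ?_ ?_ ?_ ?_ ?_).mono (by norm_num) ?_)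
  · simp [evalBlock, Instr.eval]
  · intro i hi
    obtain rfl : i = 0 := by omega
    exact hpa
  · simp [Holds, evalBlock, Instr.eval, h0, h1]
  · simp [Holds, evalBlock, Instr.eval, h10, h11]
  · simp [evalBlock, Instr.eval]
  rintro r1 _ ⟨rfl, hr1, u, hi, hu, h19, h2, h10, hpu, hpw, hnone⟩
  simp only [List.forall_mem_cons, List.not_mem_nil, false_imp_iff, implies_true,
    and_true] at hr1
  obtain ⟨k0, k1, k6, k7⟩ := hr1
  obtain ⟨h2, h3⟩ := h2
  obtain ⟨h10, h11⟩ := h10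
  norm_num at h3 h11
  refine Wp.block_seq (by simp) (by simp [SafeBlock, Instr.Safe]) ?_
  refine Wp.mono (n := 82 * m + 126 + 1) (Wp.unlessLT (fun hlt => ?_) fun hlt => ?_)
    (by simp) fun _ _ h => h
  · have hlt' : hi < 1 := by
      have : (hi : ℝ) < 1 := by simpa [evalBlock, Instr.eval, h19] using hlt
      exact_mod_cast this
    refine ⟨rfl, by simp [evalBlock, Instr.eval, k6], by simp [evalBlock, Instr.eval, k7],
      p, rot u, ?_, ?_, hu.rot, Or.inl ⟨fun z hz => ?_, rfl⟩⟩
    · simp [Holds, evalBlock, Instr.eval, k0, k1, h0, h1]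
    · simp [Holds, evalBlock, Instr.eval, h10, h11]
    · exact hc.eq_of_forall_axis hd.1 (hnone hlt') hz
  have hlt' : 1 ≤ hi := by
    have : ¬ (hi : ℝ) < 1 := by simpa [evalBlock, Instr.eval, h19] using hlt
    exact_mod_cast not_lt.1 this
  have hinit := SearchInv.init hc hS hd hu hpu (hpw hlt')
  refine Wp.block_seq (by simp) (by simp [SafeBlock, Instr.Safe]) ?_
  refine Wp.seq_of_le (n := 82 * (m + 1)) (by simp; omega)
    ((search_spec hQ hS hd ?_ hinit ?_ ?_ ?_).mono le_rfl ?_)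
  · intro z hz
    obtain ⟨hx, hy⟩ := hm _ hz _ hd.1
    simp only [Prod.fst_add, Prod.snd_add, add_sub_cancel_left, abs_lt] at hx hy
    -- For an axis direction u, `det u z` is up to sign a coordinate of z, hence bounded by the
    -- extent of S.
    rcases hu with rfl | rfl | rfl | rfl <;> simp [det] <;> omega
  · simp [Holds, evalBlock, Instr.eval, k0, k1, h0, h1]
  · simp [Holds, evalBlock, Instr.eval, h2, h3]
  · simp [Holds, evalBlock, Instr.eval, h10, h11]
  rintro r2 _ ⟨rfl, hr2, u', w, h4, hinv, hl⟩
  simp only [List.forall_mem_cons, List.not_mem_nil, false_imp_iff, implies_true,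
    and_true] at hr2
  obtain ⟨l0, l1, l6, l7, l10, l11⟩ := hr2
  simp [evalBlock, Instr.eval, k0, k1, k6, k7, h0, h1, h10, h11] at l0 l1 l6 l7 l10 l11
  obtain ⟨h4, h5⟩ := h4
  norm_num at h5
  refine lineRange_seq hQ p w hinv.right_ne_zero rfl (by simp [SafeBlock, Instr.Safe])
    (by simp [Holds, evalBlock, Instr.eval, l0, l1])
    (by simp [Holds, evalBlock, Instr.eval, h4, h5]) (by simp; omega) ?_
  intro r3 lo k hr3 _ h19 hlk
  have hp0 := (hlk 0).1 (by simpa using hd.1)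
  have hp1 := (hlk 1).1 (by simpa using hinv.mem)
  have hk := (hlk k).2 ⟨by omega, le_rfl⟩
  have hsupp := hinv.supp_of_left hl hk fun t ht => ((hlk t).1 ht).2
  refine Wp.block (by simp; omega) (by simp [SafeBlock, Instr.Safe])
    ⟨rfl, ?_, ?_, p + k • w, u, ?_, ?_, hu, Or.inr ⟨⟨hd.1, ?_, ?_⟩, ?_⟩⟩
  · simp [evalBlock, Instr.eval, hr3, l6]
  · simp [evalBlock, Instr.eval, hr3, l7]
  · simp [Holds, evalBlock, Instr.eval, hr3, l0, l1, h4, h5, h19]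
  · simp [Holds, evalBlock, Instr.eval, hr3, l10, l11, rot]
  · simp only [ne_eq, left_eq_add, smul_eq_zero, not_or]
    exact ⟨by omega, hinv.right_ne_zero⟩
  · rw [add_sub_cancel_left]
    exact ⟨hk, fun z hz hz0 => (hsupp.2 z hz hz0).smul_left (by omega)⟩
  -- All of S is weakly to the left of the new edge direction w, whereas u is strictly to its right;
  -- so u is a valid unit vector for the next turn.
  · intro hcon
    have h1 := hsupp.2 u hcon hu.ne_zero
    have h2 := hinv.pos
    rw [det_swap] at h2
    rcases h1 with h1 | ⟨h1, -⟩ <;> omega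

/-- Output the vertices, beginning with the one in the registers `0`, `1` and also `6`, `7`. -/
def wrap : Frag := Frag.doWhile 12 13 <|
  (Frag.block [.output 0 1]).seq <| advance.seq <|
  Frag.block [.sub 20 0 6, .sub 21 1 7, .mul 20 20 20, .mul 21 21 21, .add 13 20 21, .const 12 0]

/-- The list `l ++ [p]` is a chain of distinct vertices starting at p₀, and `n` bounds how many more
rounds are possible. At n = 0 there would be more distinct vertices than `vertexSet` has. -/
theorem wrap_spec {C : Set Plane} {Q : LineOracle} (hQ : Q.Computes C) (hC : IsCompact C)
    (hS : LatConvex (integerPoints C)) (hc : LatticeConnected (integerPoints C)) {m : ℕ}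
    (hm : ∀ y ∈ integerPoints C, ∀ z ∈ integerPoints C,
      |y.1 - z.1| < 2 ^ m ∧ |y.2 - z.2| < 2 ^ m) {p₀ : ℤ × ℤ} (n : ℕ) :
    ∀ {p a : ℤ × ℤ} {r : ℕ → ℝ} {l : List (ℤ × ℤ)},
      (vertexSet (integerPoints C)).ncard ≤ l.length + n →
      (∀ q ∈ l ++ [p], q ∈ vertexSet (integerPoints C)) → (l ++ [p]).Nodup →
      (l ++ [p]).IsChain (Next (integerPoints C)) → (l ++ [p]).head? = some p₀ →
      IsAxis a → p + a ∉ integerPoints C → Holds r 0 p → Holds r 6 p₀ → Holds r 10 a →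
      Wp Q wrap ((82 * m + 338) * n) r (l.map latticePoint) fun _ o' =>
        ListsVerticesCCW o' (convexHull ℝ (latticePoint '' integerPoints C)) := by
  induction n with
  | zero =>
    intro p a r l hn hv hnd
    have hle : (l ++ [p]).toFinset.card ≤ (vertexSet (integerPoints C)).ncard := by
      rw [← Set.ncard_coe_finset]
      exact Set.ncard_le_ncard (fun q hq => hv q (List.mem_toFinset.1 hq)) (finite_vertexSet hC)
    rw [List.toFinset_card_of_nodup hnd, List.length_append, List.length_singleton] at hle
    omega
  | succ n ih =>
    intro p a r l hn hv hnd hch hhd ha hpa h0 h6 h10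
    obtain ⟨d, hd⟩ := hv p (by simp)
    have hp₀ : p₀ ∈ l ++ [p] := List.mem_of_head? hhd
    have hp₀S : p₀ ∈ integerPoints C := by
      obtain ⟨d₀, h⟩ := hv p₀ hp₀
      exact h.1
    refine Wp.mono (n := 82 * m + 337 + 1 + (82 * m + 338) * n) (Wp.doWhile ?_)
      (by rw [mul_add]; omega) fun _ _ h => h
    refine Wp.seq_of_le (n := 1) (by omega) (Wp.output ?_)
    have hout : l.map latticePoint ++ [!₂[r 0, r 1]] = (l ++ [p]).map latticePoint := by
      rw [h0.1, show r 1 = (p.2 : ℝ) from h0.2, List.map_append]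
      rfl
    rw [hout]
    refine Wp.seq_of_le (n := 82 * m + 330) (by omega)
      ((advance_spec hQ hS hc hm hd ha hpa h0 h10).mono le_rfl ?_)
    rintro r' _ ⟨rfl, h6', h7', q, a', h0', h10', ha', hq⟩
    obtain ⟨h0', h1'⟩ := h0'
    obtain ⟨h6, h7⟩ := h6
    obtain ⟨h10', h11'⟩ := h10'
    norm_num at h1' h7 h11'
    rw [h6] at h6'
    rw [h7] at h7'
    have h13 : evalBlock [.sub 20 0 6, .sub 21 1 7, .mul 20 20 20, .mul 21 21 21, .add 13 20 21,
        .const 12 0] r' 13 = (dot (q - p₀) (q - p₀) : ℤ) := by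
      simp [evalBlock, Instr.eval, h0', h1', h6', h7', dot]
    have h12 : evalBlock [.sub 20 0 6, .sub 21 1 7, .mul 20 20 20, .mul 21 21 21, .add 13 20 21,
        .const 12 0] r' 12 = 0 := by
      simp [evalBlock, Instr.eval]
    refine Wp.block (by simp) (by simp [SafeBlock, Instr.Safe]) ?_
    rw [h12, h13, Int.cast_pos]
    rcases hq with ⟨hsing, rfl⟩ | ⟨hnext, hqa⟩
    · rw [hsing p₀ hp₀S, sub_self]
      refine ⟨fun h => absurd h (by simp [dot]), fun _ => ?_⟩
      have hl : l = [] := by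
        rw [List.eq_nil_iff_forall_not_mem]
        intro x hx
        obtain ⟨e, he⟩ := hv x (by simp [hx])
        exact List.disjoint_of_nodup_append hnd hx (by simp [hsing x he.1])
      have hSq : integerPoints C = {q} :=
        Set.eq_singleton_iff_unique_mem.2 ⟨hd.1, hsing⟩
      rw [hl, hSq]
      exact listsVerticesCCW_singleton q
    have hget := List.isChain_iff_getElem.1 hch
    have hlen : (l ++ [p]).length = l.length + 1 := by simp
    have hlast : (l ++ [p])[l.length] = p := by simp
    refine ⟨fun hlt => ?_, fun hlt => ?_⟩
    · have hne : q ≠ p₀ := by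
        rintro rfl
        simp [dot] at hlt
      -- If the new vertex were already on the list after p₀, its predecessor there would equal p,
      -- the last entry, against distinctness.
      have hq' : q ∉ l ++ [p] := by
        intro hmem
        obtain ⟨j, hj, hjq⟩ := List.getElem_of_mem hmem
        rcases j with - | j
        · rw [List.head?_eq_getElem?, List.getElem?_eq_getElem hj, hjq] at hhd
          exact hne (Option.some_injective _ hhd)
        · have h1 := hget j (by omega)
          rw [hjq] at h1
          obtain ⟨e, he⟩ := hv _ (List.getElem_mem (show j < (l ++ [p]).length by omega))
          have h2 := h1.injective hnext he hd
          have h3 := hnd.getElem_inj_iff.1 (h2.trans hlast.symm)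
          omega
      refine (ih (l := l ++ [p]) (by simp; omega) ?_ ?_ ?_ ?_ ha' hqa ?_ ?_ ?_)
      · intro x hx
        rw [List.mem_append, List.mem_singleton] at hx
        rcases hx with hx | rfl
        · exact hv x hx
        · exact ⟨_, hnext.2.2⟩
      · exact hnd.append (List.nodup_singleton _) (List.disjoint_singleton.2 hq')
      · refine List.isChain_append.2 ⟨hch, List.isChain_singleton _, fun x hx y hy => ?_⟩
        simp only [List.getLast?_append, List.getLast?_singleton, Option.some_or,
          Option.mem_def, Option.some.injEq, List.head?_cons] at hx hy
        rwa [← hx, ← hy]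
      · rw [List.head?_append, hhd]
        rfl
      · simp [Holds, evalBlock, Instr.eval, h0', h1']
      · simp [Holds, evalBlock, Instr.eval, h6', h7']
      · simp [Holds, evalBlock, Instr.eval, h10', h11']
    · have hq0 : q = p₀ := by
        by_contra hne
        exact hlt (dot_self_pos (sub_ne_zero.2 hne))
      refine listsVerticesCCW_of_next (by simp) hnd fun i hi => ?_
      by_cases h : i + 1 < (l ++ [p]).length
      · simp only [Nat.mod_eq_of_lt h]
        exact hget i h
      · obtain rfl : i = l.length := by omega
        simp only [hlen, Nat.mod_self]
        rw [hlast]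
        rw [List.head?_eq_getElem?, List.getElem?_eq_getElem (by omega), ← hq0] at hhd
        rw [Option.some_injective _ hhd]
        exact hnext

/-! ### The first vertex -/

/-- Double the number `d` in register `8` until the row `d` below the point in the registers
`0`, `1` contains no lattice point of the input set. -/
def gallop : Frag := Frag.doWhile 18 9 <|
  (Frag.block [.add 8 8 8]).seq <|
  (Frag.block [.copy 20 0, .sub 21 1 8, .const 22 1, .const 23 0]).seq <| lineRange.seq <|
  Frag.block [.const 9 1, .add 9 19 9]

theorem row_nonempty_iff {S : Set (ℤ × ℤ)} {x y lo hi : ℤ}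
    (h : ∀ t : ℤ, (x, y) + t • ((1, 0) : ℤ × ℤ) ∈ S ↔ lo ≤ t ∧ t ≤ hi) :
    (∃ x', (x', y) ∈ S) ↔ lo ≤ hi := by
  constructor
  · rintro ⟨x', hx'⟩
    have := (h (x' - x)).1 (by simpa using hx')
    omega
  · intro hle
    exact ⟨x + lo, by simpa using (h lo).2 ⟨le_rfl, hle⟩⟩

theorem gallop_spec {C : Set Plane} {Q : LineOracle} (hQ : Q.Computes C) {m : ℕ}
    (hm : ∀ y ∈ integerPoints C, ∀ z ∈ integerPoints C,
      |y.1 - z.1| < 2 ^ m ∧ |y.2 - z.2| < 2 ^ m) {v : ℤ × ℤ} (hv : v ∈ integerPoints C)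
    {o : List Plane} (n : ℕ) : ∀ {k : ℕ} {r : ℕ → ℝ}, k + n + 1 = m → r 8 = 2 ^ k → Holds r 0 v →
      Wp Q gallop (37 * (n + 1)) r o fun r' o' => o' = o ∧ Holds r' 0 v ∧
        ∃ k' : ℕ, k' < m ∧ r' 8 = 2 ^ (k' + 1) ∧ ¬ ∃ x, (x, v.2 - 2 ^ (k' + 1)) ∈ integerPoints C := by
  have main : ∀ {k : ℕ} {r : ℕ → ℝ}, r 8 = 2 ^ k → Holds r 0 v →
      Wp Q ((Frag.block [.add 8 8 8]).seq <|
        (Frag.block [.copy 20 0, .sub 21 1 8, .const 22 1, .const 23 0]).seq <| lineRange.seq <|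
        Frag.block [.const 9 1, .add 9 19 9]) 36 r o fun r' o' => o' = o ∧ Holds r' 0 v ∧
        r' 8 = 2 ^ (k + 1) ∧
        (r' 18 < r' 9 ↔ ∃ x, (x, v.2 - 2 ^ (k + 1)) ∈ integerPoints C) := by
    intro k r h8 h0
    obtain ⟨h0, h1⟩ := h0
    norm_num at h1
    refine Wp.block_seq (by simp) (by simp [SafeBlock, Instr.Safe]) ?_
    refine lineRange_seq hQ (v.1, v.2 - 2 ^ (k + 1)) (1, 0) (by simp) rfl
      (by simp [SafeBlock, Instr.Safe]) ?_ (by simp [Holds, evalBlock, Instr.eval]) (by simp) ?_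
    · simp only [Holds, evalBlock, Instr.eval]
      simp [h0, h1, h8]
      ring
    intro r1 lo hi hr1 h18 h19 hlh
    refine Wp.block (by simp) (by simp [SafeBlock, Instr.Safe]) ⟨rfl, ?_, ?_, ?_⟩
    · simp [Holds, evalBlock, Instr.eval, hr1, h0, h1]
    · simp [evalBlock, Instr.eval, hr1, h8]
      ring
    -- Comparing `lo` with `hi` + 1 turns the strict jump test into `lo` ≤ `hi`, that is, into the
    -- row being nonempty.
    · rw [row_nonempty_iff hlh, ← Int.lt_add_one_iff, ← @Int.cast_lt ℝ]
      simp [evalBlock, Instr.eval, h18, h19]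
  induction n with
  | zero =>
    intro k r hk h8 h0
    refine Wp.mono (n := 36 + 1 + 0) (Wp.doWhile ((main h8 h0).mono le_rfl ?_)) (by simp)
      fun _ _ h => h
    rintro r' _ ⟨rfl, h0', h8', hlt⟩
    refine ⟨fun h => ?_, fun h => ⟨rfl, h0', k, by omega, h8', fun he => h (hlt.2 he)⟩⟩
    obtain ⟨x, hx⟩ := hlt.1 h
    have := (hm _ hv _ hx).2
    rw [show k + 1 = m by omega] at this
    simp [abs_of_pos] at this
  | succ n ih =>
    intro k r hk h8 h0
    refine Wp.mono (n := 36 + 1 + 37 * (n + 1)) (Wp.doWhile ((main h8 h0).mono le_rfl ?_))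
      (by omega) fun _ _ h => h
    rintro r' _ ⟨rfl, h0', h8', hlt⟩
    exact ⟨fun _ => ih (k := k + 1) (by omega) h8' h0',
      fun h => ⟨rfl, h0', k, by omega, h8', fun he => h (hlt.2 he)⟩⟩

/-- Move the point in the registers `0`, `1` down to the lowest row, by halving the number in
register `8`. -/
def bisect : Frag := Frag.doWhile 9 8 <|
  (Frag.block [.const 9 2, .div 8 8 9]).seq <|
  (Frag.block [.copy 20 0, .sub 21 1 8, .const 22 1, .const 23 0]).seq <| lineRange.seq <|
  (Frag.unlessLT 19 18 (Frag.block [.sub 1 1 8])).seq <| Frag.block [.const 9 1]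

/-- The invariant is only that row y is occupied and row y - 2^(n+1) is empty. Whichever way the
middle row falls, one half keeps this property, so no monotonicity of the rows is needed. -/
theorem bisect_spec {C : Set Plane} {Q : LineOracle} (hQ : Q.Computes C) {x : ℤ}
    {o : List Plane} (n : ℕ) : ∀ {y : ℤ} {r : ℕ → ℝ}, r 8 = 2 ^ (n + 1) → Holds r 0 (x, y) →
      (∃ x', (x', y) ∈ integerPoints C) → (¬ ∃ x', (x', y - 2 ^ (n + 1)) ∈ integerPoints C) →
      Wp Q bisect (39 * (n + 1)) r o fun r' o' => o' = o ∧
        ∃ y', Holds r' 0 (x, y') ∧ (∃ x', (x', y') ∈ integerPoints C) ∧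
          ¬ ∃ x', (x', y' - 1) ∈ integerPoints C := by
  have main : ∀ {n : ℕ} {y : ℤ} {r : ℕ → ℝ}, r 8 = 2 ^ (n + 1) → Holds r 0 (x, y) →
      (∃ x', (x', y) ∈ integerPoints C) → (¬ ∃ x', (x', y - 2 ^ (n + 1)) ∈ integerPoints C) →
      Wp Q ((Frag.block [.const 9 2, .div 8 8 9]).seq <|
        (Frag.block [.copy 20 0, .sub 21 1 8, .const 22 1, .const 23 0]).seq <| lineRange.seq <|
        (Frag.unlessLT 19 18 (Frag.block [.sub 1 1 8])).seq <| Frag.block [.const 9 1]) 38 r o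
      fun r' o' => o' = o ∧ r' 9 = 1 ∧ r' 8 = 2 ^ n ∧ ∃ y', Holds r' 0 (x, y') ∧
        (∃ x', (x', y') ∈ integerPoints C) ∧ ¬ ∃ x', (x', y' - 2 ^ n) ∈ integerPoints C := by
    intro n y r h8 h0 hy hy'
    obtain ⟨h0, h1⟩ := h0
    norm_num at h0 h1
    have h8' : r 8 / 2 = 2 ^ n := by rw [h8, pow_succ]; ring
    refine Wp.block_seq (by simp) (by simp [SafeBlock, Instr.Safe, Instr.eval]) ?_
    refine lineRange_seq hQ (x, y - 2 ^ n) (1, 0) (by simp) rfl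
      (by simp [SafeBlock, Instr.Safe]) ?_ (by simp [Holds, evalBlock, Instr.eval]) (by simp) ?_
    · simp [Holds, evalBlock, Instr.eval, h0, h1, h8']
    intro r1 lo hi hr1 h18 h19 hlh
    have hrow := row_nonempty_iff hlh
    have k0 : r1 0 = x := by simp [hr1, evalBlock, Instr.eval, h0]
    have k1 : r1 1 = y := by simp [hr1, evalBlock, Instr.eval, h1]
    have k8 : r1 8 = 2 ^ n := by simp [hr1, evalBlock, Instr.eval, h8']
    refine Wp.seq_of_le (n := 1 + 1) (by simp) (Wp.unlessLT (fun hlt => ?_) fun hlt =>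
      Wp.block (by simp) (by simp [SafeBlock, Instr.Safe]) ?_)
    · refine Wp.block (by simp) (by simp [SafeBlock, Instr.Safe])
        ⟨rfl, by simp [evalBlock, Instr.eval], by simp [evalBlock, Instr.eval, k8], y, ?_, hy, ?_⟩
      · simp [Holds, evalBlock, Instr.eval, k0, k1]
      · rw [hrow, not_le]
        rw [h18, h19] at hlt
        exact_mod_cast hlt
    · refine Wp.block (by simp) (by simp [SafeBlock, Instr.Safe])
        ⟨rfl, by simp [evalBlock, Instr.eval], by simp [evalBlock, Instr.eval, k8], y - 2 ^ n,
          ?_, ?_, ?_⟩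
      · simp [Holds, evalBlock, Instr.eval, k0, k1, k8]
      · rw [hrow]
        rw [h18, h19, not_lt] at hlt
        exact_mod_cast hlt
      · rwa [sub_sub, ← two_mul, ← pow_succ']
  induction n with
  | zero =>
    intro y r h8 h0 hy hy'
    refine Wp.mono (n := 38 + 1 + 0) (Wp.doWhile ((main h8 h0 hy hy').mono le_rfl ?_)) (by simp)
      fun _ _ h => h
    rintro r' _ ⟨rfl, h9, h8', h⟩
    exact ⟨fun hlt => absurd hlt (by simp [h9, h8']), fun _ => ⟨rfl, by simpa using h⟩⟩
  | succ n ih =>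
    intro y r h8 h0 hy hy'
    refine Wp.mono (n := 38 + 1 + 39 * (n + 1))
      (Wp.doWhile ((main h8 h0 hy hy').mono le_rfl ?_)) (by omega) fun _ _ h => h
    rintro r' _ ⟨rfl, h9, h8', y', h0', hy1, hy2⟩
    refine ⟨fun _ => ih h8' h0' hy1 hy2, fun hlt => absurd ?_ hlt⟩
    rw [h9, h8']
    exact one_lt_pow₀ one_lt_two (by omega)

/-- Move to the last lattice point of the row, and prepare the output of the vertices. -/
def lastOfRow : Frag :=
  (Frag.block [.copy 20 0, .copy 21 1, .const 22 1, .const 23 0]).seq <| lineRange.seq <|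
  Frag.block [.add 0 0 19, .copy 6 0, .copy 7 1, .const 10 0, .const 11 (-1)]

theorem lastOfRow_spec {C : Set Plane} {Q : LineOracle} (hQ : Q.Computes C)
    (hc : LatticeConnected (integerPoints C)) {x y : ℤ} {r : ℕ → ℝ} {o : List Plane}
    (h0 : Holds r 0 (x, y)) (hy : ∃ x', (x', y) ∈ integerPoints C)
    (hy' : ¬ ∃ x', (x', y - 1) ∈ integerPoints C) :
    Wp Q lastOfRow 38 r o fun r' o' => o' = o ∧ ∃ p a : ℤ × ℤ, Supp (integerPoints C) p (1, 0) ∧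
      IsAxis a ∧ p + a ∉ integerPoints C ∧ Holds r' 0 p ∧ Holds r' 6 p ∧ Holds r' 10 a := by
  obtain ⟨h0, h1⟩ := h0
  norm_num at h0 h1
  refine lineRange_seq hQ (x, y) (1, 0) (by simp) rfl
    (by simp [SafeBlock, Instr.Safe]) (by simp [Holds, evalBlock, Instr.eval, h0, h1])
    (by simp [Holds, evalBlock, Instr.eval]) (by simp) ?_
  intro r1 lo hi hr1 _ h19 hlh
  have hle := (row_nonempty_iff hlh).1 hy
  refine Wp.block (by simp) (by simp [SafeBlock, Instr.Safe])
    ⟨rfl, (x + hi, y), (0, -1), supp_of_row hc ?_ ?_ ?_, by simp [IsAxis], ?_, ?_, ?_, ?_⟩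
  · simpa using (hlh hi).2 ⟨hle, le_rfl⟩
  · exact fun x' hx' => hy' ⟨x', hx'⟩
  · intro t ht
    have := (hlh (hi + t)).1 (by simpa [add_assoc] using ht)
    omega
  · exact fun h => hy' ⟨x + hi, by simpa [sub_eq_add_neg] using h⟩
  · simp [Holds, evalBlock, Instr.eval, hr1, h0, h1, h19]
  · simp [Holds, evalBlock, Instr.eval, hr1, h0, h1, h19]
  · simp [Holds, evalBlock, Instr.eval]

/-- The algorithm: find the last point of the lowest row, and go around the hull from there. -/
def hullCode : Frag :=
  (Frag.block [.const 8 1]).seq <| gallop.seq <| bisect.seq <| lastOfRow.seq wrap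

theorem hullCode_spec {C : Set Plane} {Q : LineOracle} (hQ : Q.Computes C) (hC : IsCompact C)
    (hS : LatConvex (integerPoints C)) (hc : LatticeConnected (integerPoints C)) {m : ℕ}
    (hm0 : 0 < m) (hm : ∀ y ∈ integerPoints C, ∀ z ∈ integerPoints C,
      |y.1 - z.1| < 2 ^ m ∧ |y.2 - z.2| < 2 ^ m) {v : ℤ × ℤ} (hv : v ∈ integerPoints C)
    {r : ℕ → ℝ} (h0 : Holds r 0 v) :
    Wp Q hullCode (1 + (37 * m + (39 * m + (38 +
      (82 * m + 338) * (vertexSet (integerPoints C)).ncard)))) r [] fun _ o' =>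
        ListsVerticesCCW o' (discreteHull C) := by
  obtain ⟨h0, h1⟩ := h0
  norm_num at h1
  obtain ⟨m, rfl⟩ := Nat.exists_eq_add_of_lt hm0
  rw [zero_add] at *
  refine Wp.seq (Wp.block (by simp) (by simp [SafeBlock, Instr.Safe]) ?_)
  refine Wp.seq ((gallop_spec hQ hm hv m (k := 0) (by omega) ?_ ?_).mono le_rfl ?_)
  · simp [evalBlock, Instr.eval]
  · simp [Holds, evalBlock, Instr.eval, h0, h1]
  rintro r1 _ ⟨rfl, h0, k, hk, h8, hrow⟩
  refine Wp.seq ((bisect_spec hQ k h8 h0 ⟨_, hv⟩ hrow).mono (by omega) ?_)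
  rintro r2 _ ⟨rfl, y, h0, hy, hy'⟩
  refine Wp.seq ((lastOfRow_spec hQ hc h0 hy hy').mono le_rfl ?_)
  rintro r3 _ ⟨rfl, p, a, hp, ha, hpa, h0, h6, h10⟩
  rw [discreteHull_eq]
  exact wrap_spec hQ hC hS hc hm _ (l := []) (by simp) (by simpa using ⟨_, hp⟩) (by simp)
    (by simp) (by simp) ha hpa h0 h6 h10

/-! ### The theorem -/

/-- The machine program. -/
def hullProgram : Program := hullCode 0 ++ [.halt]

set_option maxRecDepth 10000 in
theorem below_hullProgram : ∀ i ∈ hullProgram, i.Below 32 = true := by decide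

/-- A number of binary digits that suffices for the extent of a set of diameter `δ`. -/
theorem exists_digits {δ : ℝ} (hδ : 0 ≤ δ) :
    ∃ m : ℕ, 0 < m ∧ δ < 2 ^ m ∧ (m : ℝ) ≤ 2 / Real.log 2 * Real.log (2 + δ) := by
  have h2 : (1 : ℝ) ≤ Real.logb 2 (2 + δ) := by
    rw [Real.le_logb_iff_rpow_le one_lt_two (by linarith), Real.rpow_one]
    linarith
  refine ⟨⌊Real.logb 2 (2 + δ)⌋₊ + 1, Nat.succ_pos _, ?_, ?_⟩
  · have h := Nat.lt_floor_add_one (Real.logb 2 (2 + δ))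
    rw [Real.logb_lt_iff_lt_rpow one_lt_two (by linarith), ← Nat.cast_succ,
      Real.rpow_natCast, Nat.succ_eq_add_one] at h
    linarith
  · have h := Nat.floor_le (zero_le_one.trans h2)
    push_cast
    calc (⌊Real.logb 2 (2 + δ)⌋₊ : ℝ) + 1 ≤ 2 * Real.logb 2 (2 + δ) := by linarith
      _ = 2 / Real.log 2 * Real.log (2 + δ) := by rw [← Real.log_div_log]; ring

theorem ListsVerticesCCW.length_eq {l : List Plane} {K : Set Plane} (h : ListsVerticesCCW l K) :
    l.length = numVertices K := by
  classical
  rw [numVertices, ← h.2.1, ← List.toFinset_card_of_nodup h.1, ← Set.ncard_coe_finset]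
  congr 1
  ext x
  simp

theorem mainTheorem1 :
    ∃ (P : Program) (T : ℝ) (S : ℕ),
      ∀ (C : Set Plane), IsCompact C → Convex ℝ C →
        LatticeConnected (integerPoints C) →
        ∀ Q : LineOracle, Q.Computes C →
        ∀ v : ℤ × ℤ, v ∈ integerPoints C →
          ∃ (n : ℕ) (c : Config), HaltsAfter P Q (Config.init v) n c ∧
            ListsVerticesCCW c.out (discreteHull C) ∧
            (n : ℝ) ≤ T * ((numVertices (discreteHull C) : ℝ) *
              Real.log (2 + Metric.diam C)) ∧
            c.used.card ≤ S := by
  refine ⟨hullProgram, 1200 / Real.log 2, 32, fun C hC hconv hconn Q hQ v hv => ?_⟩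
  obtain ⟨m, hm0, hm, hmlog⟩ := exists_digits (Metric.diam_nonneg (s := C))
  have hm' : ∀ y ∈ integerPoints C, ∀ z ∈ integerPoints C,
      |y.1 - z.1| < 2 ^ m ∧ |y.2 - z.2| < 2 ^ m := fun y hy z hz => by
    obtain ⟨h1, h2⟩ := abs_fst_sub_le_diam hC hy hz
    exact ⟨by exact_mod_cast h1.trans_lt hm, by exact_mod_cast h2.trans_lt hm⟩
  obtain ⟨n, hn, r, o, U, hrun, hout⟩ := hullCode_spec hQ hC (latConvex_integerPoints hconv) hconn
    hm0 hm' hv (r := (Config.init v).reg) ⟨by simp [Config.init], by simp [Config.init]⟩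
    hullProgram 0 ⟨[], [.halt], rfl, rfl⟩ {0, 1}
  refine ⟨n, _, ⟨hrun, ?_⟩, hout, ?_, ?_⟩
  · simp [hullProgram]
  · have hpos : 0 < numVertices (discreteHull C) := by
      rw [← hout.length_eq, List.length_pos_iff]
      rintro rfl
      have hne : (discreteHull C).Nonempty :=
        ⟨_, subset_convexHull ℝ _ ⟨hv, v, rfl⟩⟩
      have hcomp : IsCompact (discreteHull C) := by
        rw [discreteHull_eq]
        exact ((finite_integerPoints hC).image _).isCompact_convexHull (𝕜 := ℝ)
      obtain ⟨x, hx⟩ := hcomp.extremePoints_nonempty hne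
      rw [← hout.2.1] at hx
      simp at hx
    -- The cost is (82m + 338)·|V| + 76m + 39, and both m and the number of vertices are at least 1,
    -- so all terms are absorbed: 82 + 338 + 76 + 39 ≤ 600. The factor 2 / log 2 from the choice of
    -- m then gives 1200 / log 2.
    have hle : n ≤ 600 * (m * numVertices (discreteHull C)) := by
      have h1 := ncard_vertexSet_le hC
      generalize numVertices (discreteHull C) = N at *
      have h2 : (82 * m + 338) * (vertexSet (integerPoints C)).ncard ≤ (82 * m + 338) * N :=
        Nat.mul_le_mul_left _ h1
      have h3 : m ≤ m * N := Nat.le_mul_of_pos_right _ hpos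
      have h4 : N ≤ m * N := Nat.le_mul_of_pos_left _ hm0
      have h5 : (82 * m + 338) * N = 82 * (m * N) + 338 * N := by ring
      omega
    calc (n : ℝ) ≤ 600 * (m * numVertices (discreteHull C)) := by exact_mod_cast hle
      _ ≤ 600 * (2 / Real.log 2 * Real.log (2 + Metric.diam C) *
          numVertices (discreteHull C)) := by gcongr
      _ = _ := by ring
  · refine (Finset.card_le_card (used_runFor_subset (B := 32) below_hullProgram hrun ?_)).trans
      (by simp)
    intro i hi
    simp only [Finset.mem_insert, Finset.mem_singleton] at hi
    simp only [Finset.mem_range]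
    omega
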